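/- A real $\gamma$ is \emph{left-c.e.} if it is the limit of a nondecreasing computable sequence $\langle\gamma\rangle=(\gamma_s)_{s\in\mathbb N}$ of rationals; such a sequence is called a \emph{left-c.e. approximation} of $\gamma$. Its additive cost function is $c_{\langle\gamma\rangle}(x,s)=\gamma_s-\gamma_x$ for $x\le s$, and $c_{\langle\gamma\rangle}(x,s)=0$ for $x>s$. A cost function $c$ (a computable function $\mathbb N\times\mathbb N\to\mathbb Q_{\ge 0}$) is \emph{proper} if for each $x$ there is $t$ with $c(x,t)>0$; so $c_{\langle\gamma\rangle}$ is proper iff $\langle\gamma\rangle$ is not eventually constant, which is always the case when $\gamma$ is irrational. A computable approximation of a set $A\subseteq\mathbb N$ is a computable sequence $(A_s)_{s\in\mathbb N}$ of finite sets (given by lists of their elements) converging pointwise to $A$. It \emph{obeys} $c$ if $\sum_{s>0}c_s(A_s)<\infty$, where $c_s(A_s)=c(x,s)$ for the least $x$ with $A_{s-1}(x)\ne A_s(x)$ if such an $x$ exists and $x<s$, and $c_s(A_s)=0$ otherwise. A set $A$ \emph{obeys} $c$ if some computable approximation of $A$ does; and $c\to d$ means that each $\Delta^0_2$ set that obeys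 $c$ also obeys $d$. Let $\mathbb Q_2$ be the set of dyadic rationals. $\beta\le_S\alpha$ (\emph{Solovay reducibility}) means that there are a partial computable function $\varphi\colon\mathbb Q_2\cap[0,\alpha)\to\mathbb Q_2\cap[0,\beta)$, defined on all of $\mathbb Q_2\cap[0,\alpha)$, and $N\in\mathbb N$ such that $\beta-\varphi(q)<N(\alpha-q)$ for each $q\in\mathbb Q_2\cap[0,\alpha)$. Let $\alpha,\beta$ be positive left-c.e. reals. Then the following are equivalent: (i) $\beta\le_S\alpha$; (ii) for every left-c.e. approximation $\langle\alpha\rangle$ of $\alpha$ such that $c_{\langle\alpha\rangle}$ is proper there is a left-c.e. approximation $\langle\beta\rangle$ of $\beta$ with $c_{\langle\alpha\rangle}\to c_{\langle\beta\rangle}$; (iii) there are left-c.e. approximations $\langle\alpha\rangle$ of $\alpha$ and $\langle\beta\rangle$ of $\beta$ with $c_{\langle\alpha\rangle}\to c_{\langle\beta\rangle}$. -/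

import Mathlib

open Filter Topology
open scoped ENNReal

namespace CostFunctions

/-! ### Left-c.e. reals -/

/-- A sequence of rationals is effective if numerators (as differences of natural numbers) and
positive denominators of its terms can be computed from the index. -/
def EffectiveRatSeq (a : ℕ → ℚ) : Prop :=
  ∃ p m d : ℕ → ℕ, Computable p ∧ Computable m ∧ Computable d ∧
    ∀ n, a n = ((p n : ℚ) - (m n : ℚ)) / ((d n : ℚ) + 1)

/-- `a` is a left-c.e. approximation of `γ`: a nondecreasing effective sequence of rationals
converging to `γ`. -/
structure IsLeftCEApprox (a : ℕ → ℚ) (γ : ℝ) : Prop where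
  effective : EffectiveRatSeq a
  monotone : Monotone a
  tendsto : Tendsto (fun s => (a s : ℝ)) atTop (𝓝 γ)

/-- A real is left-c.e. if it has a left-c.e. approximation. -/
def IsLeftCE (γ : ℝ) : Prop := ∃ a : ℕ → ℚ, IsLeftCEApprox a γ

/-! ### Solovay reducibility -/

/-- The nonnegative dyadic rationals. -/
def NonnegDyadic : Type := {q : ℚ // ∃ m k : ℕ, q = (m : ℚ) / 2 ^ k}

/-- The nonnegative dyadic rational `m / 2 ^ k` denoted by the pair `(m, k)`. -/
def NonnegDyadic.ofPair (p : ℕ × ℕ) : NonnegDyadic :=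
  ⟨(p.1 : ℚ) / 2 ^ p.2, p.1, p.2, rfl⟩

/-- The real number given by a nonnegative dyadic rational. -/
def NonnegDyadic.toReal (q : NonnegDyadic) : ℝ := ((q.1 : ℚ) : ℝ)

/-- A partial function on the nonnegative dyadic rationals is partial computable if it is
realized by a partial computable function on the pairs `(m, k)` that denote them. -/
def PartialComputable (φ : NonnegDyadic →. NonnegDyadic) : Prop :=
  ∃ f : ℕ × ℕ →. ℕ × ℕ, Partrec f ∧
    ∀ p : ℕ × ℕ, (f p).map NonnegDyadic.ofPair = φ (NonnegDyadic.ofPair p)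

/-- `SolovayLE β α` is `β ≤_S α`: there are `N` and a partial computable `φ`, defined on exactly
the dyadic rationals in `[0, α)` and with dyadic values in `[0, β)`, such that
`β - φ(q) < N (α - q)` for each dyadic `q` in `[0, α)`. -/
def SolovayLE (β α : ℝ) : Prop :=
  ∃ (φ : NonnegDyadic →. NonnegDyadic) (N : ℕ), PartialComputable φ ∧
    (∀ q, (φ q).Dom ↔ q.toReal < α) ∧
    ∀ q, ∀ r ∈ φ q, r.toReal < β ∧ β - r.toReal < (N : ℝ) * (α - q.toReal)

/-! ### Cost functions and obedience -/

/-- `A` is a computable sequence of finite sets: from `s` one can compute a list of all elements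
of `A s`. -/
def ComputableFinsetSeq (A : ℕ → Finset ℕ) : Prop :=
  ∃ L : ℕ → List ℕ, Computable L ∧ ∀ s, (L s).toFinset = A s

/-- `A` is a computable approximation of the set `S`: a computable sequence of finite sets
converging pointwise to `S`. -/
def IsComputableApprox (A : ℕ → Finset ℕ) (S : Set ℕ) : Prop :=
  ComputableFinsetSeq A ∧ ∀ x, ∀ᶠ s in atTop, (x ∈ A s ↔ x ∈ S)

open Classical in
/-- The cost of changing `A s` to `A (s + 1)`: it is `c x (s + 1)`, where `x` is the least number
on which the two sets differ, if `x < s + 1`; it is `0` if there is no such `x`. -/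
noncomputable def changeCost (c : ℕ → ℕ → ℚ) (A : ℕ → Finset ℕ) (s : ℕ) : ℚ :=
  if h : ∃ x, x < s + 1 ∧ ¬ (x ∈ A s ↔ x ∈ A (s + 1)) then c (Nat.find h) (s + 1) else 0

/-- The total cost of all changes in the sequence `A` (the costs being nonnegative). -/
noncomputable def totalCost (c : ℕ → ℕ → ℚ) (A : ℕ → Finset ℕ) : ℝ≥0∞ :=
  ∑' s, ENNReal.ofReal (changeCost c A s : ℝ)

/-- The set `S` obeys `c`: some computable approximation of `S` has finite total cost. -/
def Obeys (S : Set ℕ) (c : ℕ → ℕ → ℚ) : Prop :=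
  ∃ A : ℕ → Finset ℕ, IsComputableApprox A S ∧ totalCost c A < ⊤

/-- The implication `c → d` of cost functions. Only sets with a computable approximation, that is
`Δ⁰₂` sets, can obey a cost function. -/
def CostImplies (c d : ℕ → ℕ → ℚ) : Prop := ∀ S : Set ℕ, Obeys S c → Obeys S d

/-- A cost function is proper if for each `x` the cost `c x t` is positive for some `t`. -/
def IsProper (c : ℕ → ℕ → ℚ) : Prop := ∀ x, ∃ t, 0 < c x t

/-- The additive cost function given by a nondecreasing sequence of rationals. -/
def additiveCost (a : ℕ → ℚ) (x s : ℕ) : ℚ := if x ≤ s then a s - a x else 0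

theorem additiveCost_nonneg {a : ℕ → ℚ} (ha : Monotone a) (x s : ℕ) : 0 ≤ additiveCost a x s := by
  unfold additiveCost
  split_ifs with h
  · exact sub_nonneg.2 (ha h)
  · exact le_rfl

end CostFunctions

/-! Solovay reducibility is tied to domination of tails, `β - b n ≤ N * (α - a n)`. From (i) to
(ii), applying `φ` to dyadics between `a s` and `α` gives numbers below `β` whose distance from `β`
is at most `N * (α - a s)`. Let `b` climb towards them, but never by more than `N` times the
increment of `a`. The tails stay dominated, so `b` still reaches `β`, and the cost function of `b`
is at most `N` times that of `a` (`exists_costImplies_of_solovayLE`). For (iii), a proper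
approximation of `α` always exists.

From (iii) to (i), suppose reducibility fails. By `solovayLE_of_forall_ge_le` there are, for each
`e`, arbitrarily large `x` with `2 ^ e * (α - a x) < β - b x`. A set `A` is built that obeys the
cost function of `a` but not that of `b`. If program `e` computes a sequence `E` and `E i` agrees
with `A` on a suitable `x`, then `x` is moved into or out of `A`. This costs less than `(b i - b x)
/ 2 ^ e` with respect to `a`; if `E` later agrees with `A` on `x` again, that costs `E` at least `b
i - b x` with respect to `b`.

Conflicts are settled by priority: a program may cancel an attempt of a larger code on the same
number. An attempt puts twice its gap, divided by `2 ^ e`, into a potential; one half pays for the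
change of `A`, the other for the cancelled attempt. The potential is bounded, so `A` has finite cost
(`obeys_limitSet`) and each number is used finitely often (`eventually_not_acts`). An approximation
`E` of `A` may be assumed to cost less than `1`, and `faithful_config` shows that it really pays for
its answered attempts, so the cap on gains never protects it. Then some fixed `x` would remain
eligible and would force one more action on a number up to `x`, too late for that to happen
(`not_obeys_limitSet`). -/

namespace CostFunctions

/-! ### Computable rational-valued functions -/

/-- The rational `(p - m) / (d + 1)` denoted by the triple `(p, m, d)`. -/
def ratVal (r : ℕ × ℕ × ℕ) : ℚ := ((r.1 : ℚ) - (r.2.1 : ℚ)) / ((r.2.2 : ℚ) + 1)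

theorem exists_ratVal_eq (q : ℚ) : ∃ r, ratVal r = q := by
  refine ⟨(q.num.toNat, (-q.num).toNat, q.den - 1), ?_⟩
  have hd : ((q.den - 1 : ℕ) : ℚ) + 1 = q.den := by
    have := q.pos
    exact_mod_cast Nat.sub_add_cancel this
  have hn : (q.num.toNat : ℚ) - ((-q.num).toNat : ℚ) = q.num := by
    have : ((q.num.toNat : ℕ) : ℤ) - ((-q.num).toNat : ℤ) = q.num := by omega
    exact_mod_cast this
  simp only [ratVal, hd, hn, Rat.num_div_den]

section Arithmetic

open Primrec

/-- Addition of rationals on triples. -/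
def ratAdd (r s : ℕ × ℕ × ℕ) : ℕ × ℕ × ℕ :=
  (r.1 * (s.2.2 + 1) + s.1 * (r.2.2 + 1), r.2.1 * (s.2.2 + 1) + s.2.1 * (r.2.2 + 1),
    r.2.2 * s.2.2 + r.2.2 + s.2.2)

/-- Multiplication of rationals on triples. -/
def ratMul (r s : ℕ × ℕ × ℕ) : ℕ × ℕ × ℕ :=
  (r.1 * s.1 + r.2.1 * s.2.1, r.1 * s.2.1 + r.2.1 * s.1, r.2.2 * s.2.2 + r.2.2 + s.2.2)

/-- Negation of rationals on triples. -/
def ratNeg (r : ℕ × ℕ × ℕ) : ℕ × ℕ × ℕ := (r.2.1, r.1, r.2.2)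

theorem ratVal_add (r s : ℕ × ℕ × ℕ) : ratVal (ratAdd r s) = ratVal r + ratVal s := by
  have h1 : (r.2.2 : ℚ) + 1 ≠ 0 := by positivity
  have h2 : (s.2.2 : ℚ) + 1 ≠ 0 := by positivity
  have h3 : (r.2.2 : ℚ) * s.2.2 + r.2.2 + s.2.2 + 1 ≠ 0 := by positivity
  simp only [ratVal, ratAdd]
  push_cast
  rw [div_add_div _ _ h1 h2, div_eq_div_iff h3 (mul_ne_zero h1 h2)]
  ring

theorem ratVal_mul (r s : ℕ × ℕ × ℕ) : ratVal (ratMul r s) = ratVal r * ratVal s := by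
  have h1 : (r.2.2 : ℚ) + 1 ≠ 0 := by positivity
  have h2 : (s.2.2 : ℚ) + 1 ≠ 0 := by positivity
  have h3 : (r.2.2 : ℚ) * s.2.2 + r.2.2 + s.2.2 + 1 ≠ 0 := by positivity
  simp only [ratVal, ratMul]
  push_cast
  rw [div_mul_div_comm, div_eq_div_iff h3 (mul_ne_zero h1 h2)]
  ring

theorem ratVal_neg (r : ℕ × ℕ × ℕ) : ratVal (ratNeg r) = - ratVal r := by
  simp only [ratVal, ratNeg]
  rw [← neg_div, neg_sub]

theorem ratVal_lt_iff (r s : ℕ × ℕ × ℕ) : ratVal r < ratVal s ↔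
    r.1 * (s.2.2 + 1) + s.2.1 * (r.2.2 + 1) < s.1 * (r.2.2 + 1) + r.2.1 * (s.2.2 + 1) := by
  have h1 : (0 : ℚ) < (r.2.2 : ℚ) + 1 := by positivity
  have h2 : (0 : ℚ) < (s.2.2 : ℚ) + 1 := by positivity
  rw [ratVal, ratVal, div_lt_div_iff₀ h1 h2, ← Nat.cast_lt (α := ℚ)]
  push_cast
  constructor <;> intro h <;> linarith

theorem primrec_num : Primrec fun r : ℕ × ℕ × ℕ => r.1 := fst
theorem primrec_sub : Primrec fun r : ℕ × ℕ × ℕ => r.2.1 := fst.comp snd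
theorem primrec_den : Primrec fun r : ℕ × ℕ × ℕ => r.2.2 := snd.comp snd
theorem primrec_den_succ : Primrec fun r : ℕ × ℕ × ℕ => r.2.2 + 1 := succ.comp primrec_den

theorem primrec_ratAdd : Primrec₂ ratAdd :=
  Primrec.pair
    (nat_add.comp
      (nat_mul.comp (primrec_num.comp fst) (primrec_den_succ.comp snd))
      (nat_mul.comp (primrec_num.comp snd) (primrec_den_succ.comp fst)))
    (Primrec.pair
      (nat_add.comp
        (nat_mul.comp (primrec_sub.comp fst) (primrec_den_succ.comp snd))
        (nat_mul.comp (primrec_sub.comp snd) (primrec_den_succ.comp fst)))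
      (nat_add.comp
        (nat_add.comp (nat_mul.comp (primrec_den.comp fst) (primrec_den.comp snd))
          (primrec_den.comp fst))
        (primrec_den.comp snd)))

theorem primrec_ratMul : Primrec₂ ratMul :=
  Primrec.pair
    (nat_add.comp
      (nat_mul.comp (primrec_num.comp fst) (primrec_num.comp snd))
      (nat_mul.comp (primrec_sub.comp fst) (primrec_sub.comp snd)))
    (Primrec.pair
      (nat_add.comp
        (nat_mul.comp (primrec_num.comp fst) (primrec_sub.comp snd))
        (nat_mul.comp (primrec_sub.comp fst) (primrec_num.comp snd)))
      (nat_add.comp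
        (nat_add.comp (nat_mul.comp (primrec_den.comp fst) (primrec_den.comp snd))
          (primrec_den.comp fst))
        (primrec_den.comp snd)))

theorem primrec_ratNeg : Primrec ratNeg :=
  Primrec.pair primrec_sub (Primrec.pair primrec_num primrec_den)

theorem primrecRel_ratVal_lt : PrimrecRel fun r s : ℕ × ℕ × ℕ => ratVal r < ratVal s := by
  refine PrimrecPred.of_eq (nat_lt.comp
    (nat_add.comp (nat_mul.comp (primrec_num.comp fst) (primrec_den_succ.comp snd))
      (nat_mul.comp (primrec_sub.comp snd) (primrec_den_succ.comp fst)))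
    (nat_add.comp (nat_mul.comp (primrec_num.comp snd) (primrec_den_succ.comp fst))
      (nat_mul.comp (primrec_sub.comp fst) (primrec_den_succ.comp snd)))) fun p => ?_
  exact (ratVal_lt_iff p.1 p.2).symm

end Arithmetic

section Effective

variable {ι κ : Type*} [Primcodable ι] [Primcodable κ]

/-- A rational-valued function is effective if it is computable on codes. -/
def EffRat (f : ι → ℚ) : Prop := ∃ g : ι → ℕ × ℕ × ℕ, Computable g ∧ ∀ i, f i = ratVal (g i)

theorem effRat_iff_effectiveRatSeq {a : ℕ → ℚ} : EffRat a ↔ EffectiveRatSeq a := by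
  constructor
  · rintro ⟨g, hg, h⟩
    exact ⟨fun n => (g n).1, fun n => (g n).2.1, fun n => (g n).2.2, Computable.fst.comp hg,
      Computable.fst.comp (Computable.snd.comp hg), Computable.snd.comp (Computable.snd.comp hg), h⟩
  · rintro ⟨p, m, d, hp, hm, hd, h⟩
    exact ⟨fun n => (p n, m n, d n), hp.pair (hm.pair hd), h⟩

theorem effRat_ratVal : EffRat ratVal := ⟨id, Computable.id, fun _ => rfl⟩

namespace EffRat

variable {f g : ι → ℚ}

theorem of_eq (hf : EffRat f) (h : ∀ i, g i = f i) : EffRat g :=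
  let ⟨u, hu, e⟩ := hf
  ⟨u, hu, fun i => (h i).trans (e i)⟩

theorem comp (hf : EffRat f) {u : κ → ι} (hu : Computable u) : EffRat fun k => f (u k) :=
  let ⟨v, hv, e⟩ := hf
  ⟨fun k => v (u k), hv.comp hu, fun k => e (u k)⟩

theorem const (q : ℚ) : EffRat fun _ : ι => q :=
  let ⟨r, hr⟩ := exists_ratVal_eq q
  ⟨fun _ => r, Computable.const r, fun _ => hr.symm⟩

theorem natCast {n : ι → ℕ} (hn : Computable n) : EffRat fun i => (n i : ℚ) :=
  ⟨fun i => (n i, 0, 0), hn.pair (Computable.const (0, 0)), fun i => by simp [ratVal]⟩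

theorem inv_succ {n : ι → ℕ} (hn : Computable n) : EffRat fun i => ((n i : ℚ) + 1)⁻¹ :=
  ⟨fun i => (1, 0, n i), (Computable.const 1).pair ((Computable.const 0).pair hn),
    fun i => by simp [ratVal]⟩

theorem add (hf : EffRat f) (hg : EffRat g) : EffRat fun i => f i + g i :=
  let ⟨u, hu, e⟩ := hf
  let ⟨v, hv, e'⟩ := hg
  ⟨fun i => ratAdd (u i) (v i), primrec_ratAdd.to_comp.comp hu hv,
    fun i => by rw [ratVal_add, ← e, ← e']⟩

theorem mul (hf : EffRat f) (hg : EffRat g) : EffRat fun i => f i * g i :=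
  let ⟨u, hu, e⟩ := hf
  let ⟨v, hv, e'⟩ := hg
  ⟨fun i => ratMul (u i) (v i), primrec_ratMul.to_comp.comp hu hv,
    fun i => by rw [ratVal_mul, ← e, ← e']⟩

theorem neg (hf : EffRat f) : EffRat fun i => - f i :=
  let ⟨u, hu, e⟩ := hf
  ⟨fun i => ratNeg (u i), primrec_ratNeg.to_comp.comp hu, fun i => by rw [ratVal_neg, ← e]⟩

theorem sub (hf : EffRat f) (hg : EffRat g) : EffRat fun i => f i - g i :=
  (hf.add hg.neg).of_eq fun _ => sub_eq_add_neg _ _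

theorem lt (hf : EffRat f) (hg : EffRat g) : ComputablePred fun i => f i < g i := by
  obtain ⟨u, hu, e⟩ := hf
  obtain ⟨v, hv, e'⟩ := hg
  refine Computable.computablePred ((primrecRel_ratVal_lt.decide.to_comp.comp
    hu hv).of_eq fun i => ?_)
  simp [e, e']

theorem ite {c : ι → Prop} [DecidablePred c] (hc : ComputablePred c) (hf : EffRat f)
    (hg : EffRat g) : EffRat fun i => if c i then f i else g i := by
  obtain ⟨u, hu, e⟩ := hf
  obtain ⟨v, hv, e'⟩ := hg
  refine ⟨_, Computable.cond hc.decide hu hv, fun i => ?_⟩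
  by_cases h : c i <;> simp [h, e, e']

theorem max (hf : EffRat f) (hg : EffRat g) : EffRat fun i => Max.max (f i) (g i) := by
  refine (ite (hf.lt hg) hg hf).of_eq fun i => ?_
  split_ifs with h
  · exact max_eq_right h.le
  · exact max_eq_left (not_lt.1 h)

theorem min (hf : EffRat f) (hg : EffRat g) : EffRat fun i => Min.min (f i) (g i) := by
  refine (ite (hf.lt hg) hf hg).of_eq fun i => ?_
  split_ifs with h
  · exact min_eq_left h.le
  · exact min_eq_right (not_lt.1 h)

/-- The recursion is run on triples, so the step need only be effective in a code of the previous
value. -/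
theorem nat_rec {n : ι → ℕ} (hn : Computable n) (hf : EffRat f) {h : ι → ℕ → ℚ → ℚ}
    (hh : EffRat fun p : ι × ℕ × (ℕ × ℕ × ℕ) => h p.1 p.2.1 (ratVal p.2.2)) :
    EffRat fun i => Nat.rec (motive := fun _ => ℚ) (f i) (h i) (n i) := by
  obtain ⟨u, hu, e⟩ := hf
  obtain ⟨v, hv, e'⟩ := hh
  refine ⟨fun i => Nat.rec (motive := fun _ => ℕ × ℕ × ℕ) (u i) (fun k r => v (i, k, r)) (n i),
    Computable.nat_rec hn hu (h := fun i q => v (i, q.1, q.2)) hv, fun i => ?_⟩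
  beta_reduce
  generalize n i = k
  induction k with
  | zero => exact e i
  | succ k ih =>
    change h i k _ = ratVal (v (i, k, _))
    rw [ih]
    exact e' (i, k, _)

theorem option_elim {o : ι → Option κ} (ho : Computable o) (hf : EffRat f) {h : ι × κ → ℚ}
    (hh : EffRat h) : EffRat fun i => (o i).elim (f i) fun k => h (i, k) := by
  obtain ⟨u, hu, e⟩ := hf
  obtain ⟨v, hv, e'⟩ := hh
  refine ⟨_, Computable.option_casesOn ho hu (g := fun i k => v (i, k)) hv, fun i => ?_⟩
  beta_reduce
  cases o i with
  | none => exact e i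
  | some k => exact e' (i, k)

/-- Sums over prefixes are computed by recursion on the length; reading past the end contributes
`0`. -/
theorem list_sum {l : ι → List κ} (hl : Computable l) {h : ι × κ → ℚ} (hh : EffRat h) :
    EffRat fun i => ((l i).map fun k => h (i, k)).sum := by
  have hget : Computable fun p : ι × ℕ × (ℕ × ℕ × ℕ) => (l p.1)[p.2.1]? :=
    Computable.list_getElem?.comp (hl.comp .fst) (Computable.fst.comp .snd)
  have := nat_rec (n := fun i => (l i).length) (Computable.list_length.comp hl) (const 0)
    (h := fun i n y => y + ((l i)[n]?).elim 0 fun k => h (i, k))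
    ((effRat_ratVal.comp (Computable.snd.comp .snd)).add
      (option_elim hget (const 0)
        (hh.comp ((Computable.fst.comp .fst).pair .snd))))
  refine this.of_eq fun i => ?_
  have key : ∀ n, n ≤ (l i).length → (((l i).take n).map fun k => h (i, k)).sum =
      Nat.rec (motive := fun _ => ℚ) 0
        (fun n y => y + ((l i)[n]?).elim 0 fun k => h (i, k)) n := by
    intro n
    induction n with
    | zero => intro _; simp
    | succ n ih =>
      intro hn
      have hn' : n < (l i).length := hn
      simp only [← ih hn'.le, List.take_add_one, List.map_append, List.sum_append,
        List.getElem?_eq_getElem hn', Option.elim_some, Option.toList_some, List.map_cons,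
        List.map_nil, List.sum_cons, List.sum_nil, add_zero]
  have := key _ le_rfl
  rwa [List.take_length] at this

end EffRat

end Effective

section Predicates

variable {ι κ : Type*} [Primcodable ι] [Primcodable κ]

theorem computablePred_and {p q : ι → Prop} (hp : ComputablePred p) (hq : ComputablePred q) :
    ComputablePred fun i => p i ∧ q i := by
  classical
  refine Computable.computablePred ((Computable.cond hp.decide hq.decide
    (Computable.const false)).of_eq fun i => ?_)
  by_cases h : p i <;> simp [h]

theorem computablePred_or {p q : ι → Prop} (hp : ComputablePred p) (hq : ComputablePred q) :
    ComputablePred fun i => p i ∨ q i := by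
  classical
  refine Computable.computablePred ((Computable.cond hp.decide (Computable.const true)
    hq.decide).of_eq fun i => ?_)
  by_cases h : p i <;> simp [h]

theorem computablePred_comp {p : ι → Prop} (hp : ComputablePred p) {u : κ → ι}
    (hu : Computable u) : ComputablePred fun k => p (u k) := by
  classical
  exact Computable.computablePred (hp.decide.comp hu)

theorem computable_ite {σ : Type*} [Primcodable σ] {c : ι → Prop} [DecidablePred c]
    (hc : ComputablePred c) {f g : ι → σ} (hf : Computable f) (hg : Computable g) :
    Computable fun i => if c i then f i else g i := by
  refine (Computable.cond hc.decide hf hg).of_eq fun i => ?_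
  by_cases h : c i <;> simp [h]

theorem computable_two_pow : Computable fun n : ℕ => 2 ^ n :=
  (Primrec₂.comp (f := fun m n : ℕ => m ^ n) (Primrec₂.unpaired'.1 Nat.Primrec.pow)
    (Primrec.const 2) Primrec.id).to_comp

theorem effRat_dyadic : EffRat fun p : ℕ × ℕ => (p.1 : ℚ) / 2 ^ p.2 := by
  refine ((EffRat.natCast Computable.fst).mul (EffRat.inv_succ (Computable.pred.comp
    (computable_two_pow.comp Computable.snd)))).of_eq fun p => ?_
  have : ((Nat.pred (2 ^ p.2) : ℕ) : ℚ) + 1 = 2 ^ p.2 := by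
    exact_mod_cast Nat.succ_pred_eq_of_pos (Nat.two_pow_pos p.2)
  simp only [this, div_eq_mul_inv]

end Predicates

/-- Between two rationals, the smaller one nonnegative, there is a dyadic rational. -/
theorem exists_dyadic_between {u v : ℚ} (hu : 0 ≤ u) (huv : u < v) :
    ∃ p : ℕ × ℕ, u < (p.1 : ℚ) / 2 ^ p.2 ∧ (p.1 : ℚ) / 2 ^ p.2 < v := by
  obtain ⟨k, hk⟩ := exists_pow_lt_of_lt_one (sub_pos.2 huv) (by norm_num : (1 / 2 : ℚ) < 1)
  have h2 : (0 : ℚ) < 2 ^ k := by positivity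
  refine ⟨(⌊u * 2 ^ k⌋₊ + 1, k), ?_, ?_⟩
  · rw [lt_div_iff₀ h2]
    exact_mod_cast Nat.lt_floor_add_one (u * 2 ^ k)
  · have h := Nat.floor_le (mul_nonneg hu h2.le)
    rw [one_div, inv_pow] at hk
    rw [div_lt_iff₀ h2]
    have : 1 < (v - u) * 2 ^ k := by
      have := mul_lt_mul_of_pos_right hk h2
      rwa [inv_mul_cancel₀ h2.ne'] at this
    push_cast
    nlinarith

/-! ### Approximations and Solovay reducibility -/

theorem IsLeftCEApprox.effRat {a : ℕ → ℚ} {α : ℝ} (ha : IsLeftCEApprox a α) : EffRat a :=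
  effRat_iff_effectiveRatSeq.2 ha.effective

theorem IsLeftCEApprox.le {a : ℕ → ℚ} {α : ℝ} (ha : IsLeftCEApprox a α) (s : ℕ) :
    (a s : ℝ) ≤ α :=
  Monotone.ge_of_tendsto (fun _ _ h => Rat.cast_le.2 (ha.monotone h)) ha.tendsto s

theorem IsLeftCEApprox.eventually_lt {a : ℕ → ℚ} {α : ℝ} (ha : IsLeftCEApprox a α) {u : ℝ}
    (hu : u < α) : ∀ᶠ s in atTop, u < a s :=
  ha.tendsto.eventually_const_lt hu

/-- Given `q`, search for `s ≥ n₀` with `q < a s` and a dyadic just below `b s`. The permitted error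
`a s - q` is at most `α - q`, which is why the constant becomes `N + 1`. -/
theorem solovayLE_of_forall_ge_le {α β : ℝ} {a b : ℕ → ℚ} (ha : IsLeftCEApprox a α)
    (hb : IsLeftCEApprox b β) (hβ : 0 < β) (N n₀ : ℕ)
    (h : ∀ n ≥ n₀, β - b n ≤ N * (α - a n)) : SolovayLE β α := by
  classical
  let T : ℚ → ℕ × ℕ × ℕ → Prop := fun q w =>
    n₀ ≤ w.1 ∧ q < a w.1 ∧ b w.1 - (a w.1 - q) < (w.2.1 : ℚ) / 2 ^ w.2.2 ∧
      (w.2.1 : ℚ) / 2 ^ w.2.2 < b w.1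
  let dec : ℕ → ℕ × ℕ × ℕ := Denumerable.ofNat (ℕ × ℕ × ℕ)
  have hdec : Computable dec := Computable.ofNat _
  let search : ℚ → Part ℕ := fun q => Nat.rfind fun n => Part.some (decide (T q (dec n)))
  have hs : Computable fun p : (ℕ × ℕ) × ℕ => (dec p.2).1 :=
    Computable.fst.comp (hdec.comp Computable.snd)
  have hq : EffRat fun p : (ℕ × ℕ) × ℕ => (p.1.1 : ℚ) / 2 ^ p.1.2 :=
    effRat_dyadic.comp (u := fun p : (ℕ × ℕ) × ℕ => p.1) Computable.fst
  have hr : EffRat fun p : (ℕ × ℕ) × ℕ => ((dec p.2).2.1 : ℚ) / 2 ^ (dec p.2).2.2 :=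
    effRat_dyadic.comp (u := fun p : (ℕ × ℕ) × ℕ => (dec p.2).2)
      (Computable.snd.comp (hdec.comp Computable.snd))
  have ha' : EffRat fun p : (ℕ × ℕ) × ℕ => a (dec p.2).1 := ha.effRat.comp hs
  have hb' : EffRat fun p : (ℕ × ℕ) × ℕ => b (dec p.2).1 := hb.effRat.comp hs
  have hn₀ : ComputablePred fun p : (ℕ × ℕ) × ℕ => n₀ ≤ (dec p.2).1 :=
    computablePred_comp (p := fun n => n₀ ≤ n)
      (PrimrecPred.computablePred (Primrec.nat_le.comp (Primrec.const n₀) Primrec.id)) hs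
  have hT : ComputablePred fun p : (ℕ × ℕ) × ℕ => T ((p.1.1 : ℚ) / 2 ^ p.1.2) (dec p.2) :=
    computablePred_and hn₀ (computablePred_and (hq.lt ha')
      (computablePred_and ((hb'.sub (ha'.sub hq)).lt hr) (hr.lt hb')))
  have hspec : ∀ q n, n ∈ search q → T q (dec n) := by
    intro q n hn
    simpa using Nat.rfind_spec hn
  refine ⟨fun q => (search q.1).map fun n => NonnegDyadic.ofPair (dec n).2, N + 1,
    ⟨fun p => (search ((p.1 : ℚ) / 2 ^ p.2)).map fun n => (dec n).2, ?_, ?_⟩, ?_, ?_⟩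
  · exact Partrec.map (Partrec.rfind hT.decide.partrec)
      (Computable.snd.comp (hdec.comp Computable.snd))
  · intro p
    simp only [Part.map_map]
    rfl
  · intro q
    change (search q.1).Dom ↔ _
    constructor
    · intro hd
      obtain ⟨-, h1, -⟩ := hspec _ _ (Part.get_mem hd)
      exact lt_of_lt_of_le (Rat.cast_lt.2 h1) (ha.le _)
    · intro hlt
      obtain ⟨s, hs, hsn, hsb⟩ := ((ha.eventually_lt hlt).and
        ((eventually_ge_atTop n₀).and (hb.eventually_lt hβ))).exists
      have h1 : q.1 < a s := Rat.cast_lt.1 hs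
      have h2 : 0 < b s := by exact_mod_cast hsb
      -- Values of the reduction must be nonnegative, hence the `0`; it lies below `b s` because `0
      -- < β` and `s` is late.
      obtain ⟨p, hp1, hp2⟩ := exists_dyadic_between (u := max 0 (b s - (a s - q.1))) (v := b s)
        (le_max_left _ _) (max_lt h2 (by linarith))
      refine Nat.rfind_dom.2 ⟨Encodable.encode (s, p), ?_, fun _ => trivial⟩
      have : T q.1 (dec (Encodable.encode (s, p))) := by
        simp only [dec, Denumerable.ofNat_encode]
        exact ⟨hsn, h1, lt_of_le_of_lt (le_max_right _ _) hp1, hp2⟩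
      exact Part.mem_some_iff.2 (decide_eq_true this).symm
  · intro q r hr
    obtain ⟨n, hn, rfl⟩ := (Part.mem_map_iff _).1 hr
    obtain ⟨h0, h1, h2, h3⟩ := hspec _ _ hn
    generalize dec n = w at *
    have e : (NonnegDyadic.ofPair w.2).toReal = (((w.2.1 : ℚ) / 2 ^ w.2.2 : ℚ) : ℝ) := rfl
    rw [e]
    refine ⟨lt_of_lt_of_le (Rat.cast_lt.2 h3) (hb.le _), ?_⟩
    have h4 := h _ h0
    have h5 : (b w.1 : ℝ) - (a w.1 - q.1) < (((w.2.1 : ℚ) / 2 ^ w.2.2 : ℚ) : ℝ) := by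
      exact_mod_cast h2
    have h6 : (q.1 : ℝ) < a w.1 := Rat.cast_lt.2 h1
    have h7 := ha.le w.1
    have h8 : (0 : ℝ) ≤ N := Nat.cast_nonneg N
    have h9 : q.toReal = (q.1 : ℝ) := rfl
    have h10 : (N : ℝ) * (α - a w.1) ≤ N * (α - q.1) :=
      mul_le_mul_of_nonneg_left (by linarith) h8
    rw [h9]
    push_cast
    push_cast at h5
    linarith

theorem changeCost_le_mul {c d : ℕ → ℕ → ℚ} {N : ℚ} (h : ∀ x s, d x s ≤ N * c x s)
    (A : ℕ → Finset ℕ) (s : ℕ) : changeCost d A s ≤ N * changeCost c A s := by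
  unfold changeCost
  split_ifs
  · exact h _ _
  · simp

/-- The same approximation of the set serves for both cost functions. -/
theorem costImplies_of_le_mul {c d : ℕ → ℕ → ℚ} (N : ℕ) (h : ∀ x s, d x s ≤ N * c x s) :
    CostImplies c d := by
  rintro S ⟨A, hA, hc⟩
  refine ⟨A, hA, lt_of_le_of_lt ?_ (ENNReal.mul_lt_top (ENNReal.natCast_lt_top N) hc)⟩
  unfold totalCost
  rw [← ENNReal.tsum_mul_left]
  refine ENNReal.tsum_le_tsum fun s => ?_
  rw [← ENNReal.ofReal_natCast, ← ENNReal.ofReal_mul (Nat.cast_nonneg N)]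
  refine ENNReal.ofReal_le_ofReal ?_
  exact_mod_cast changeCost_le_mul h A s

theorem additiveCost_le_mul {a b : ℕ → ℚ} {N : ℚ}
    (h : ∀ s, b (s + 1) - b s ≤ N * (a (s + 1) - a s)) (x s : ℕ) :
    additiveCost b x s ≤ N * additiveCost a x s := by
  unfold additiveCost
  split_ifs with hx
  · induction s, hx using Nat.le_induction with
    | base => simp
    | succ s _ ih => linarith [h s]
  · simp

theorem exists_costImplies_of_solovayLE {α β : ℝ} (hα : 0 < α) (h : SolovayLE β α) {a : ℕ → ℚ}
    (ha : IsLeftCEApprox a α) (hp : IsProper (additiveCost a)) :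
    ∃ b, IsLeftCEApprox b β ∧ CostImplies (additiveCost a) (additiveCost b) := by
  classical
  obtain ⟨φ, N, ⟨f, hf, hfφ⟩, hdom, hφ⟩ := h
  let dec : ℕ → ℕ × ℕ × ℕ := Denumerable.ofNat (ℕ × ℕ × ℕ)
  have hdec : Computable dec := Computable.ofNat _
  let T : ℕ → ℕ → Prop := fun s n =>
    ¬ ((dec n).2.1 : ℚ) / 2 ^ (dec n).2.2 < a s ∧
      ((dec n).2.1 : ℚ) / 2 ^ (dec n).2.2 < a (dec n).1
  have hq : EffRat fun p : ℕ × ℕ => ((dec p.2).2.1 : ℚ) / 2 ^ (dec p.2).2.2 :=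
    effRat_dyadic.comp (u := fun p : ℕ × ℕ => (dec p.2).2)
      (Computable.snd.comp (hdec.comp Computable.snd))
  have hT : ComputablePred fun p : ℕ × ℕ => T p.1 p.2 :=
    computablePred_and (hq.lt (ha.effRat.comp Computable.fst)).not
      (hq.lt (ha.effRat.comp (u := fun p : ℕ × ℕ => (dec p.2).1)
        (Computable.fst.comp (hdec.comp Computable.snd))))
  -- Properness puts a later value strictly above `a s`, and `0 < α` leaves room for a nonnegative
  -- dyadic.
  have hex : ∀ s, ∃ n, T s n := by
    intro s
    obtain ⟨t₁, ht₁⟩ := hp s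
    have h1 : a s < a t₁ := by
      unfold additiveCost at ht₁
      split_ifs at ht₁ with h
      · exact sub_pos.1 ht₁
      · exact absurd ht₁ (lt_irrefl _)
    obtain ⟨t₂, ht₂⟩ := (ha.eventually_lt hα).exists
    have h2 : 0 < a t₂ := by exact_mod_cast ht₂
    have h3 : max 0 (a s) < a (max t₁ t₂) :=
      max_lt (h2.trans_le (ha.monotone (le_max_right _ _)))
        (h1.trans_le (ha.monotone (le_max_left _ _)))
    obtain ⟨p, hp1, hp2⟩ := exists_dyadic_between (le_max_left _ _) h3
    refine ⟨Encodable.encode (max t₁ t₂, p), ?_⟩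
    simp only [T, dec, Denumerable.ofNat_encode]
    exact ⟨not_lt.2 ((le_max_right _ _).trans hp1.le), hp2⟩
  let q : ℕ → ℕ × ℕ := fun s => (dec (Nat.find (hex s))).2
  have hqc : Computable q := Computable.snd.comp (hdec.comp (Computable.find hT hex))
  have hq1 : ∀ s, (a s : ℝ) ≤ (NonnegDyadic.ofPair (q s)).toReal := fun s =>
    Rat.cast_le.2 (not_lt.1 (Nat.find_spec (hex s)).1)
  have hq2 : ∀ s, (NonnegDyadic.ofPair (q s)).toReal < α := fun s =>
    lt_of_lt_of_le (Rat.cast_lt.2 (Nat.find_spec (hex s)).2) (ha.le _)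
  have hd : ∀ s, (f (q s)).Dom := by
    intro s
    have := (hdom _).2 (hq2 s)
    rw [← hfφ] at this
    exact this
  let g : ℕ → ℕ × ℕ := fun s => (f (q s)).get (hd s)
  have hg : Computable g :=
    (hf.comp hqc).of_eq_tot fun s => Part.get_mem (hd s)
  let r : ℕ → ℚ := fun s => ((g s).1 : ℚ) / 2 ^ (g s).2
  have hr : EffRat r := effRat_dyadic.comp hg
  have hrφ : ∀ s, (r s : ℝ) < β ∧ β - r s ≤ N * (α - a s) := by
    intro s
    have hmem : NonnegDyadic.ofPair (g s) ∈ φ (NonnegDyadic.ofPair (q s)) := by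
      rw [← hfφ]
      exact Part.mem_map _ (Part.get_mem (hd s))
    obtain ⟨h1, h2⟩ := hφ _ _ hmem
    refine ⟨h1, h2.le.trans (mul_le_mul_of_nonneg_left ?_ (Nat.cast_nonneg N))⟩
    linarith [hq1 s]
  -- The cap `y + N * (a (n + 1) - a n)` bounds the cost. It does not spoil convergence: where it
  -- takes effect, `N * (α - a n)` shrinks by no more than `β - b n` does; elsewhere `b` reaches `r
  -- (n + 1)`, which is close enough to `β`.
  let b : ℕ → ℚ := fun s => Nat.rec (motive := fun _ => ℚ) (r 0)
    (fun n y => max y (min (r (n + 1)) (y + N * (a (n + 1) - a n)))) s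
  have hb0 : b 0 = r 0 := rfl
  have hbs : ∀ n, b (n + 1) = max (b n) (min (r (n + 1)) (b n + N * (a (n + 1) - a n))) :=
    fun _ => rfl
  have hbeff : EffRat b := by
    have hn : Computable fun p : ℕ × ℕ × (ℕ × ℕ × ℕ) => p.2.1 :=
      Computable.fst.comp Computable.snd
    have hn1 : Computable fun p : ℕ × ℕ × (ℕ × ℕ × ℕ) => p.2.1 + 1 :=
      Computable.succ.comp hn
    have hv : EffRat fun p : ℕ × ℕ × (ℕ × ℕ × ℕ) => ratVal p.2.2 :=
      effRat_ratVal.comp (Computable.snd.comp Computable.snd)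
    exact EffRat.nat_rec (n := fun s : ℕ => s) (f := fun _ => r 0)
      (h := fun _ n y => max y (min (r (n + 1)) (y + N * (a (n + 1) - a n))))
      Computable.id (EffRat.const _)
      (hv.max ((hr.comp hn1).min (hv.add ((EffRat.const _).mul
        ((ha.effRat.comp hn1).sub (ha.effRat.comp hn))))))
  have hmono : Monotone b := monotone_nat_of_le_succ fun n => by
    rw [hbs]
    exact le_max_left _ _
  have hstep : ∀ n, b (n + 1) - b n ≤ N * (a (n + 1) - a n) := by
    intro n
    have h0 : 0 ≤ (N : ℚ) * (a (n + 1) - a n) :=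
      mul_nonneg (Nat.cast_nonneg N) (sub_nonneg.2 (ha.monotone n.le_succ))
    rw [hbs, sub_le_iff_le_add']
    exact max_le (by linarith) (min_le_right _ _)
  have hlt : ∀ n, (b n : ℝ) < β := by
    intro n
    induction n with
    | zero => exact (hrφ 0).1
    | succ n ih =>
      rw [hbs]
      push_cast
      exact max_lt ih ((min_le_left _ _).trans_lt (hrφ (n + 1)).1)
  have hgap : ∀ n, β - b n ≤ N * (α - a n) := by
    intro n
    induction n with
    | zero => exact (hrφ 0).2
    | succ n ih =>
      have h1 : min (r (n + 1)) (b n + N * (a (n + 1) - a n)) ≤ b (n + 1) := by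
        rw [hbs]
        exact le_max_right _ _
      rcases min_le_iff.1 h1 with h2 | h2
      · have h3 : (r (n + 1) : ℝ) ≤ b (n + 1) := Rat.cast_le.2 h2
        linarith [(hrφ (n + 1)).2]
      · have h3 : (b n + N * (a (n + 1) - a n) : ℝ) ≤ b (n + 1) := by exact_mod_cast h2
        linarith
  refine ⟨b, ⟨effRat_iff_effectiveRatSeq.1 hbeff, hmono, ?_⟩,
    costImplies_of_le_mul N (additiveCost_le_mul hstep)⟩
  have hlim : Tendsto (fun n => β - N * (α - a n)) atTop (𝓝 β) := by
    have : Tendsto (fun n => β - N * (α - (a n : ℝ))) atTop (𝓝 (β - N * (α - α))) :=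
      tendsto_const_nhds.sub ((tendsto_const_nhds.sub ha.tendsto).const_mul _)
    simpa using this
  exact tendsto_of_tendsto_of_tendsto_of_le_of_le hlim tendsto_const_nhds
    (fun n => by linarith [hgap n]) fun n => (hlt n).le

/-- Subtracting a strictly decreasing null sequence makes any approximation strictly increasing. -/
theorem exists_isProper_approx {α : ℝ} (hα : IsLeftCE α) :
    ∃ a, IsLeftCEApprox a α ∧ IsProper (additiveCost a) := by
  obtain ⟨a, ha⟩ := hα
  have hanti : StrictAnti fun n : ℕ => ((n : ℚ) + 1)⁻¹ := fun m n h => by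
    have : (m : ℚ) < n := by exact_mod_cast h
    exact inv_strictAnti₀ (by positivity) (by linarith)
  refine ⟨fun n => a n - ((n : ℚ) + 1)⁻¹, ⟨effRat_iff_effectiveRatSeq.1
    (ha.effRat.sub (EffRat.inv_succ Computable.id)),
    fun m n h => sub_le_sub (ha.monotone h) (hanti.antitone h), ?_⟩, fun x => ⟨x + 1, ?_⟩⟩
  · have h := ha.tendsto.sub (tendsto_one_div_add_atTop_nhds_zero_nat (𝕜 := ℝ))
    simpa using h
  · have h1 := ha.monotone x.le_succ
    have h2 := hanti x.lt_succ_self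
    simp only [additiveCost, Nat.le_succ, if_true]
    simp only [Nat.succ_eq_add_one] at h1 h2
    linarith

/-! ### The diagonal construction -/

/-- The stage `s` approximation to the `i`-th finite set (given by a list) in the sequence computed
by the program with code `e`. -/
def opponent (e i t : ℕ) : Option (List ℕ) :=
  (Nat.Partrec.Code.evaln t (Denumerable.ofNat Nat.Partrec.Code e) i).map
    (Denumerable.ofNat (List ℕ))

theorem primrec_opponent : Primrec fun p : ℕ × ℕ × ℕ => opponent p.1 p.2.1 p.2.2 := by
  have h : Primrec fun p : ℕ × ℕ × ℕ =>
      Nat.Partrec.Code.evaln p.2.2 (Denumerable.ofNat Nat.Partrec.Code p.1) p.2.1 :=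
    Nat.Partrec.Code.primrec_evaln.comp
      (Primrec.pair (Primrec.pair (Primrec.snd.comp Primrec.snd)
        ((Primrec.ofNat Nat.Partrec.Code).comp Primrec.fst)) (Primrec.fst.comp Primrec.snd))
  exact Primrec.option_map h ((Primrec.ofNat (List ℕ)).comp Primrec.snd).to₂

theorem opponent_mono {e i t t' : ℕ} (h : t ≤ t') {l : List ℕ} (hl : opponent e i t = some l) :
    opponent e i t' = some l := by
  unfold opponent at *
  obtain ⟨n, hn, rfl⟩ := Option.map_eq_some_iff.1 hl
  exact Option.map_eq_some_iff.2 ⟨n, Nat.Partrec.Code.evaln_mono h hn, rfl⟩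

theorem exists_opponent {l : ℕ → List ℕ} (hl : Computable l) :
    ∃ e, (∀ i, ∃ t, opponent e i t = some (l i)) ∧
      ∀ i t l', opponent e i t = some l' → l' = l i := by
  have h1 : Nat.Partrec fun n => Part.some (Encodable.encode (l n)) :=
    Partrec.nat_iff.1 (Computable.encode.comp hl).partrec
  obtain ⟨c, hc⟩ := Nat.Partrec.Code.exists_code.1 h1
  have h2 : ∀ i, ∃ t, opponent (Encodable.encode c) i t = some (l i) := by
    intro i
    have : Encodable.encode (l i) ∈ c.eval i := by
      rw [hc]
      exact Part.mem_some _
    obtain ⟨t, ht⟩ := Nat.Partrec.Code.evaln_complete.1 this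
    refine ⟨t, Option.map_eq_some_iff.2 ⟨_, ?_, Denumerable.ofNat_encode (l i)⟩⟩
    rw [Denumerable.ofNat_encode]
    exact ht
  refine ⟨Encodable.encode c, h2, fun i t l' h' => ?_⟩
  obtain ⟨t', ht'⟩ := h2 i
  have h3 := opponent_mono (le_max_left t t') h'
  rw [opponent_mono (le_max_right t t') ht'] at h3
  exact (Option.some_inj.1 h3).symm

/-- A configuration `(A, Q, W)`: the set `A` built so far, the list `Q` of pending attempts
`(e, x, i)`, and the list `W` of successful attempts with the indices at which they were answered.
In an attempt `(e, x, i)` the number `x` has been moved into or out of `A` against the program `e`,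
whose `i`-th set agreed with `A` on `x`. -/
abbrev Config := List ℕ × List (ℕ × ℕ × ℕ) × List ((ℕ × ℕ × ℕ) × ℕ)

/-- The cost that an answer to the attempt `q` incurs at least. -/
def gap (b : ℕ → ℚ) (q : ℕ × ℕ × ℕ) : ℚ := b q.2.2 - b q.2.1

/-- The cost incurred at least by the program `e` in the successful attempts `W`. -/
def gain (b : ℕ → ℚ) (W : List ((ℕ × ℕ × ℕ) × ℕ)) (e : ℕ) : ℚ :=
  (W.map fun w => if w.1.1 = e then gap b w.1 else 0).sum

/-- The program considered at stage `t`. -/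
def stageProgram (t : ℕ) : ℕ := t.unpair.1

/-- The index considered at stage `t`. -/
def stageIndex (t : ℕ) : ℕ := t.unpair.2.unpair.1

/-- `Compatible l A e x i q` means that the pending attempt `q` does not keep the program `e`, whose
`i`-th set is `l`, from an attempt with `x`. -/
def Compatible (l A : List ℕ) (e x i : ℕ) (q : ℕ × ℕ × ℕ) : Prop :=
  q.1 = e ∨ q.2.1 = x → e ≤ q.1 ∧ q.2.2 ≤ i ∧ (q.2.1 ∈ l ↔ q.2.1 ∈ A)

/-- At stage `t` the program considered may be attacked with `x`. -/
structure Eligible (a b : ℕ → ℚ) (σ : Config) (t x : ℕ) : Prop where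
  isSome : (opponent (stageProgram t) (stageIndex t) t).isSome
  le : stageProgram t ≤ x
  agree : x ∈ (opponent (stageProgram t) (stageIndex t) t).getD [] ↔ x ∈ σ.1
  -- The program's own pending attempt must have been answered. A pending attempt on the same `x`
  -- will be removed, so its priority must not be higher nor its index larger.
  pending : ∀ q ∈ σ.2.1, Compatible ((opponent (stageProgram t) (stageIndex t) t).getD []) σ.1
    (stageProgram t) x (stageIndex t) q
  -- Indices of answers never decrease, so the costs of different answers fall into disjoint
  -- intervals.
  answered : ∀ w ∈ σ.2.2, w.1.1 = stageProgram t → w.2 ≤ stageIndex t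
  gain_lt : gain b σ.2.2 (stageProgram t) < 1
  cost_lt : 2 ^ stageProgram t * (a (t + 1) - a x) < b (stageIndex t) - b x

/-- The second alternative makes the search total; reaching `stageIndex` means that no attempt is
made. -/
theorem exists_target (a b : ℕ → ℚ) (p : Config × ℕ) :
    ∃ x, Eligible a b p.1 p.2 x ∨ stageIndex p.2 ≤ x := ⟨stageIndex p.2, Or.inr le_rfl⟩

open Classical in
/-- The least number with which the program considered may be attacked. -/
noncomputable def target (a b : ℕ → ℚ) (p : Config × ℕ) : ℕ := Nat.find (exists_target a b p)

/-- The configuration after an attempt `(e, x, i)`. -/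
def attack (σ : Config) (q : ℕ × ℕ × ℕ) : Config :=
  (if q.2.1 ∈ σ.1 then σ.1.filter (fun y => y ≠ q.2.1) else q.2.1 :: σ.1,
    q :: σ.2.1.filter (fun r => r.1 ≠ q.1 ∧ r.2.1 ≠ q.2.1),
    (σ.2.1.filter (fun r => r.1 = q.1)).map (fun r => (r, q.2.2)) ++ σ.2.2)

/-- One stage of the construction. -/
noncomputable def step (a b : ℕ → ℚ) (p : Config × ℕ) : Config :=
  if target a b p < stageIndex p.2 then
    attack p.1 (stageProgram p.2, target a b p, stageIndex p.2)
  else p.1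

/-- The configuration at the beginning of stage `t`. -/
noncomputable def config (a b : ℕ → ℚ) (t : ℕ) : Config :=
  Nat.rec (motive := fun _ => Config) ([], [], []) (fun t σ => step a b (σ, t)) t

/-! ### Computability of the construction -/

section Computability

theorem primrec_stageProgram : Primrec stageProgram := Primrec.fst.comp Primrec.unpair

theorem primrec_stageIndex : Primrec stageIndex :=
  Primrec.fst.comp (Primrec.unpair.comp (Primrec.snd.comp Primrec.unpair))

theorem primrecRel_mem : PrimrecRel fun (x : ℕ) (l : List ℕ) => x ∈ l := by
  have h : PrimrecRel fun (l : List ℕ) (x : ℕ) => ∃ y ∈ l, y = x :=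
    PrimrecRel.exists_mem_list (R := fun y x : ℕ => y = x) Primrec.eq
  exact PrimrecPred.of_eq (h.comp Primrec.snd Primrec.fst) fun p => by simp

theorem primrecPred_iff {α : Type*} [Primcodable α] {p q : α → Prop} (hp : PrimrecPred p)
    (hq : PrimrecPred q) : PrimrecPred fun a => p a ↔ q a :=
  ((hp.and hq).or (hp.not.and hq.not)).of_eq fun _ => iff_iff_and_or_not_and_not.symm

theorem primrecPred_imp {α : Type*} [Primcodable α] {p q : α → Prop} (hp : PrimrecPred p)
    (hq : PrimrecPred q) : PrimrecPred fun a => p a → q a :=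
  (hp.not.or hq).of_eq fun _ => imp_iff_not_or.symm

open Primrec in
theorem primrecRel_compatible : PrimrecRel fun (q : ℕ × ℕ × ℕ)
    (p : List ℕ × List ℕ × ℕ × ℕ × ℕ) => Compatible p.1 p.2.1 p.2.2.1 p.2.2.2.1 p.2.2.2.2 q := by
  have q1 : Primrec fun r : (ℕ × ℕ × ℕ) × (List ℕ × List ℕ × ℕ × ℕ × ℕ) => r.1.1 := fst.comp fst
  have q2 : Primrec fun r : (ℕ × ℕ × ℕ) × (List ℕ × List ℕ × ℕ × ℕ × ℕ) => r.1.2.1 :=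
    fst.comp (snd.comp fst)
  have q3 : Primrec fun r : (ℕ × ℕ × ℕ) × (List ℕ × List ℕ × ℕ × ℕ × ℕ) => r.1.2.2 :=
    snd.comp (snd.comp fst)
  have l : Primrec fun r : (ℕ × ℕ × ℕ) × (List ℕ × List ℕ × ℕ × ℕ × ℕ) => r.2.1 := fst.comp snd
  have A : Primrec fun r : (ℕ × ℕ × ℕ) × (List ℕ × List ℕ × ℕ × ℕ × ℕ) => r.2.2.1 :=
    fst.comp (snd.comp snd)
  have e : Primrec fun r : (ℕ × ℕ × ℕ) × (List ℕ × List ℕ × ℕ × ℕ × ℕ) => r.2.2.2.1 :=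
    fst.comp (snd.comp (snd.comp snd))
  have x : Primrec fun r : (ℕ × ℕ × ℕ) × (List ℕ × List ℕ × ℕ × ℕ × ℕ) => r.2.2.2.2.1 :=
    fst.comp (snd.comp (snd.comp (snd.comp snd)))
  have i : Primrec fun r : (ℕ × ℕ × ℕ) × (List ℕ × List ℕ × ℕ × ℕ × ℕ) => r.2.2.2.2.2 :=
    snd.comp (snd.comp (snd.comp (snd.comp snd)))
  exact primrecPred_imp ((Primrec.eq.comp q1 e).or (Primrec.eq.comp q2 x))
    ((nat_le.comp e q1).and ((nat_le.comp q3 i).and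
      (primrecPred_iff (primrecRel_mem.comp q2 l) (primrecRel_mem.comp q2 A))))

open Primrec in
theorem primrecRel_answered : PrimrecRel fun (w : (ℕ × ℕ × ℕ) × ℕ) (p : ℕ × ℕ) =>
    w.1.1 = p.1 → w.2 ≤ p.2 :=
  primrecPred_imp (Primrec.eq.comp (fst.comp (fst.comp fst)) (fst.comp snd))
    (nat_le.comp (snd.comp fst) (snd.comp snd))

theorem effRat_gap {b : ℕ → ℚ} (hb : EffRat b) : EffRat (gap b) :=
  (hb.comp (Computable.snd.comp Computable.snd)).sub
    (hb.comp (Computable.fst.comp Computable.snd))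

open Computable in
theorem effRat_gain {b : ℕ → ℚ} (hb : EffRat b) :
    EffRat fun p : List ((ℕ × ℕ × ℕ) × ℕ) × ℕ => gain b p.1 p.2 := by
  have hc : ComputablePred fun r : (List ((ℕ × ℕ × ℕ) × ℕ) × ℕ) × ((ℕ × ℕ × ℕ) × ℕ) =>
      r.2.1.1 = r.1.2 :=
    PrimrecPred.computablePred (Primrec.eq.comp
      (Primrec.fst.comp (Primrec.fst.comp Primrec.snd)) (Primrec.snd.comp Primrec.fst))
  exact EffRat.list_sum (l := fun p : List ((ℕ × ℕ × ℕ) × ℕ) × ℕ => p.1)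
    (h := fun r => if r.2.1.1 = r.1.2 then gap b r.2.1 else 0) fst
    (EffRat.ite hc ((effRat_gap hb).comp (fst.comp snd)) (EffRat.const 0))

open Primrec in
theorem computablePred_eligible {a b : ℕ → ℚ} (ha : EffRat a) (hb : EffRat b) :
    ComputablePred fun r : (Config × ℕ) × ℕ => Eligible a b r.1.1 r.1.2 r.2 := by
  have σA : Primrec fun r : (Config × ℕ) × ℕ => r.1.1.1 := fst.comp (fst.comp fst)
  have σQ : Primrec fun r : (Config × ℕ) × ℕ => r.1.1.2.1 :=
    fst.comp (snd.comp (fst.comp fst))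
  have σW : Primrec fun r : (Config × ℕ) × ℕ => r.1.1.2.2 :=
    snd.comp (snd.comp (fst.comp fst))
  have t : Primrec fun r : (Config × ℕ) × ℕ => r.1.2 := snd.comp fst
  have x : Primrec fun r : (Config × ℕ) × ℕ => r.2 := snd
  have e : Primrec fun r : (Config × ℕ) × ℕ => stageProgram r.1.2 := primrec_stageProgram.comp t
  have i : Primrec fun r : (Config × ℕ) × ℕ => stageIndex r.1.2 := primrec_stageIndex.comp t
  have o : Primrec fun r : (Config × ℕ) × ℕ =>
      opponent (stageProgram r.1.2) (stageIndex r.1.2) r.1.2 :=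
    primrec_opponent.comp (Primrec.pair e (Primrec.pair i t))
  have l : Primrec fun r : (Config × ℕ) × ℕ =>
      (opponent (stageProgram r.1.2) (stageIndex r.1.2) r.1.2).getD [] :=
    option_getD.comp o (Primrec.const [])
  have h1 := PrimrecPred.computablePred (Primrec.eq.comp (option_isSome.comp o)
    (Primrec.const true))
  have h2 := PrimrecPred.computablePred (nat_le.comp e x)
  have h3 := PrimrecPred.computablePred
    (primrecPred_iff (primrecRel_mem.comp x l) (primrecRel_mem.comp x σA))
  have h4 := PrimrecPred.computablePred (primrecRel_compatible.forall_mem_list.comp σQ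
    (Primrec.pair l (Primrec.pair σA (Primrec.pair e (Primrec.pair x i)))))
  have h5 := PrimrecPred.computablePred (primrecRel_answered.forall_mem_list.comp σW
    (Primrec.pair e i))
  have h6 := ((effRat_gain hb).comp (Primrec.pair σW e).to_comp).lt (EffRat.const 1)
  have h7 := ((EffRat.natCast (computable_two_pow.comp e.to_comp)).mul
    ((ha.comp (succ.comp t).to_comp).sub (ha.comp x.to_comp))).lt
    ((hb.comp i.to_comp).sub (hb.comp x.to_comp))
  refine (computablePred_and h1 (computablePred_and h2 (computablePred_and h3
    (computablePred_and h4 (computablePred_and h5 (computablePred_and h6 h7)))))).of_eq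
    fun r => ⟨?_, ?_⟩
  · rintro ⟨g1, g2, g3, g4, g5, g6, g7⟩
    exact ⟨g1, g2, g3, g4, g5, g6, by simpa using g7⟩
  · rintro ⟨g1, g2, g3, g4, g5, g6, g7⟩
    exact ⟨g1, g2, g3, g4, g5, g6, by simpa using g7⟩

theorem computable_target {a b : ℕ → ℚ} (ha : EffRat a) (hb : EffRat b) :
    Computable (target a b) := by
  classical
  exact Computable.find (P := fun (p : Config × ℕ) x => Eligible a b p.1 p.2 x ∨ stageIndex p.2 ≤ x)
    (computablePred_or (computablePred_eligible ha hb) (PrimrecPred.computablePred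
      (Primrec.nat_le.comp (primrec_stageIndex.comp (Primrec.snd.comp Primrec.fst)) Primrec.snd)))
    (exists_target a b)

open Primrec in
theorem primrec_attack : Primrec₂ attack := by
  have σA : Primrec fun r : Config × (ℕ × ℕ × ℕ) => r.1.1 := fst.comp fst
  have σQ : Primrec fun r : Config × (ℕ × ℕ × ℕ) => r.1.2.1 := fst.comp (snd.comp fst)
  have σW : Primrec fun r : Config × (ℕ × ℕ × ℕ) => r.1.2.2 := snd.comp (snd.comp fst)
  have e : Primrec fun r : Config × (ℕ × ℕ × ℕ) => r.2.1 := fst.comp snd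
  have x : Primrec fun r : Config × (ℕ × ℕ × ℕ) => r.2.2.1 := fst.comp (snd.comp snd)
  have i : Primrec fun r : Config × (ℕ × ℕ × ℕ) => r.2.2.2 := snd.comp (snd.comp snd)
  have hA : Primrec₂ fun (A : List ℕ) (x : ℕ) => A.filter fun y => y ≠ x :=
    PrimrecRel.listFilter (R := fun y x : ℕ => y ≠ x) (Primrec.eq.comp fst snd).not
  have hQ : Primrec₂ fun (Q : List (ℕ × ℕ × ℕ)) (q : ℕ × ℕ × ℕ) =>
      Q.filter fun r => r.1 ≠ q.1 ∧ r.2.1 ≠ q.2.1 :=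
    PrimrecRel.listFilter (R := fun r q : ℕ × ℕ × ℕ => r.1 ≠ q.1 ∧ r.2.1 ≠ q.2.1)
      ((Primrec.eq.comp (fst.comp fst) (fst.comp snd)).not.and
        (Primrec.eq.comp (fst.comp (snd.comp fst)) (fst.comp (snd.comp snd))).not)
  have hW : Primrec₂ fun (Q : List (ℕ × ℕ × ℕ)) (q : ℕ × ℕ × ℕ) => Q.filter fun r => r.1 = q.1 :=
    PrimrecRel.listFilter (R := fun r q : ℕ × ℕ × ℕ => r.1 = q.1)
      (Primrec.eq.comp (fst.comp fst) (fst.comp snd))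
  exact Primrec.pair
    (Primrec.ite (primrecRel_mem.comp x σA) (hA.comp σA x) (list_cons.comp x σA))
    (Primrec.pair (list_cons.comp snd (hQ.comp σQ snd))
      (list_append.comp (list_map (hW.comp σQ snd)
        (Primrec.pair snd (i.comp fst)).to₂) σW))

theorem computable_step {a b : ℕ → ℚ} (ha : EffRat a) (hb : EffRat b) :
    Computable (step a b) := by
  have hi : Computable fun p : Config × ℕ => stageIndex p.2 :=
    primrec_stageIndex.to_comp.comp Computable.snd
  have he : Computable fun p : Config × ℕ => stageProgram p.2 :=
    primrec_stageProgram.to_comp.comp Computable.snd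
  have ht := computable_target ha hb
  have hlt : ComputablePred fun p : Config × ℕ => target a b p < stageIndex p.2 :=
    computablePred_comp (p := fun q : ℕ × ℕ => q.1 < q.2)
      (PrimrecPred.computablePred (Primrec.nat_lt.comp Primrec.fst Primrec.snd)) (ht.pair hi)
  exact computable_ite hlt (primrec_attack.to_comp.comp Computable.fst (he.pair (ht.pair hi)))
    Computable.fst

theorem computable_config {a b : ℕ → ℚ} (ha : EffRat a) (hb : EffRat b) :
    Computable (config a b) :=
  Computable.nat_rec (f := fun t : ℕ => t) (g := fun _ => (([], [], []) : Config))
    (h := fun _ p => step a b (p.2, p.1)) Computable.id (Computable.const _)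
    ((computable_step ha hb).comp ((Computable.snd.comp Computable.snd).pair
      (Computable.fst.comp Computable.snd)))

end Computability

/-! ### Sums over lists, grouped by a key -/

section ListSums

variable {γ : Type*}

theorem sum_map_filter (l : List γ) (p : γ → Prop) [DecidablePred p] (w : γ → ℚ) :
    ((l.filter (fun q => p q)).map w).sum = (l.map fun q => if p q then w q else 0).sum := by
  induction l with
  | nil => rfl
  | cons q l ih =>
    by_cases h : p q <;> simp [h, ih]

/-- At most one entry has key `k`. -/
theorem sum_map_ite_le_of_pairwise {l : List γ} {key : γ → ℕ} {w : γ → ℚ} {C : ℚ} (k : ℕ)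
    (hl : l.Pairwise fun q r => key q ≠ key r) (hC : 0 ≤ C)
    (hw : ∀ q ∈ l, key q = k → w q ≤ C) :
    (l.map fun q => if key q = k then w q else 0).sum ≤ C := by
  induction l with
  | nil => simpa using hC
  | cons q l ih =>
    rw [List.pairwise_cons] at hl
    simp only [List.map_cons, List.sum_cons]
    split_ifs with h
    · have h0 : (l.map fun q => if key q = k then w q else 0).sum = 0 := by
        refine List.sum_eq_zero fun y hy => ?_
        obtain ⟨r, hr, rfl⟩ := List.mem_map.1 hy
        exact if_neg fun h' => hl.1 r hr (h.trans h'.symm)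
      rw [h0, add_zero]
      exact hw q List.mem_cons_self h
    · rw [zero_add]
      exact ih hl.2 fun r hr => hw r (List.mem_cons_of_mem _ hr)

/-- Group the entries by key and compare with a geometric series. -/
theorem sum_map_div_two_pow_le {l : List γ} {key : γ → ℕ} {w : γ → ℚ} {C : ℚ}
    (hC : ∀ k, (l.map fun q => if key q = k then w q else 0).sum ≤ C) :
    (l.map fun q => w q / 2 ^ key q).sum ≤ 2 * C := by
  obtain ⟨n, hn⟩ : ∃ n, ∀ q ∈ l, key q < n := by
    clear hC
    induction l with
    | nil => exact ⟨0, fun q hq => absurd hq List.not_mem_nil⟩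
    | cons q l ih =>
      obtain ⟨n, hn⟩ := ih
      refine ⟨max n (key q + 1), fun r hr => ?_⟩
      rcases List.mem_cons.1 hr with rfl | hr
      · exact lt_of_lt_of_le (Nat.lt_succ_self _) (le_max_right _ _)
      · exact lt_of_lt_of_le (hn r hr) (le_max_left _ _)
  have h1 : (l.map fun q => w q / 2 ^ key q).sum =
      ∑ k ∈ Finset.range n, (l.map fun q => if key q = k then w q else 0).sum / 2 ^ k := by
    clear hC
    induction l with
    | nil => simp
    | cons q l ih =>
      have hq : key q ∈ Finset.range n := Finset.mem_range.2 (hn q List.mem_cons_self)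
      simp only [List.map_cons, List.sum_cons, add_div, Finset.sum_add_distrib]
      rw [ih fun r hr => hn r (List.mem_cons_of_mem _ hr)]
      congr 1
      simp only [ite_div, zero_div, Finset.sum_ite_eq, hq, if_true]
  have h0 : 0 ≤ C := by
    -- No entry has key `n`, so the sum for this key is `0`.
    have h := hC n
    rwa [List.sum_eq_zero] at h
    intro y hy
    obtain ⟨r, hr, rfl⟩ := List.mem_map.1 hy
    exact if_neg (hn r hr).ne
  have h2 : ∀ n : ℕ, ∑ k ∈ Finset.range n, C / 2 ^ k = 2 * C - 2 * C / 2 ^ n := by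
    intro n
    induction n with
    | zero => simp
    | succ n ih =>
      rw [Finset.sum_range_succ, ih, pow_succ]
      field_simp
      ring
  rw [h1]
  refine (Finset.sum_le_sum fun k _ =>
    div_le_div_of_nonneg_right (hC k) (by positivity)).trans ?_
  rw [h2]
  have : 0 ≤ 2 * C / 2 ^ n := by positivity
  linarith

end ListSums

/-! ### The potential of a configuration -/

/-- The contribution of an attempt to the potential. -/
def weight (b : ℕ → ℚ) (q : ℕ × ℕ × ℕ) : ℚ := 2 * gap b q / 2 ^ q.1

/-- The potential of a configuration: a bound for the cost of reaching it. -/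
def potential (b : ℕ → ℚ) (σ : Config) : ℚ :=
  (σ.2.1.map (weight b)).sum + (σ.2.2.map fun w => weight b w.1).sum

/-- Answered attempts keep their weight when they move to the other list. Only an attempt of another
program on the same number is lost; its code is larger and its gap no larger, so its weight is at
most half that of `q`. -/
theorem potential_attack {b : ℕ → ℚ} (hb : Monotone b) {σ : Config} {q : ℕ × ℕ × ℕ}
    (hσ : σ.2.1.Pairwise fun r s => r.2.1 ≠ s.2.1) (hq : q.2.1 ≤ q.2.2)
    (h : ∀ r ∈ σ.2.1, r.2.1 = q.2.1 → q.1 ≤ r.1 ∧ r.2.2 ≤ q.2.2) :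
    potential b σ + gap b q / 2 ^ q.1 ≤ potential b (attack σ q) := by
  have hgap : 0 ≤ gap b q := sub_nonneg.2 (hb hq)
  have h2 : (0 : ℚ) < 2 ^ q.1 := by positivity
  have hlost : (σ.2.1.map fun r => if r.2.1 = q.2.1 then
      (if r.1 = q.1 then 0 else weight b r) else 0).sum ≤ gap b q / 2 ^ q.1 := by
    refine sum_map_ite_le_of_pairwise (key := fun r : ℕ × ℕ × ℕ => r.2.1) q.2.1 hσ
      (by positivity) fun r hr hx => ?_
    obtain ⟨h3, h4⟩ := h r hr hx
    split_ifs with he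
    · positivity
    · have h5 : q.1 + 1 ≤ r.1 := lt_of_le_of_ne h3 (Ne.symm he)
      have h6 : gap b r ≤ gap b q := by
        unfold gap
        rw [hx]
        exact sub_le_sub_right (hb h4) _
      have h7 : (2 : ℚ) ^ (q.1 + 1) ≤ 2 ^ r.1 := pow_le_pow_right₀ (by norm_num) h5
      calc weight b r ≤ 2 * gap b q / 2 ^ r.1 :=
            div_le_div_of_nonneg_right (by linarith) (by positivity)
        _ ≤ 2 * gap b q / 2 ^ (q.1 + 1) :=
            div_le_div_of_nonneg_left (by positivity) (by positivity) h7
        _ = gap b q / 2 ^ q.1 := by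
            rw [pow_succ]
            field_simp
  -- The three sums are over attempts kept, answered and cancelled.
  have hsplit : (σ.2.1.map (weight b)).sum =
      (σ.2.1.map fun r => if r.1 ≠ q.1 ∧ r.2.1 ≠ q.2.1 then weight b r else 0).sum +
      (σ.2.1.map fun r => if r.1 = q.1 then weight b r else 0).sum +
      (σ.2.1.map fun r => if r.2.1 = q.2.1 then
        (if r.1 = q.1 then 0 else weight b r) else 0).sum := by
    rw [← List.sum_map_add, ← List.sum_map_add]
    congr 1
    refine List.map_congr_left fun r _ => ?_
    by_cases h1 : r.1 = q.1 <;> by_cases h2 : r.2.1 = q.2.1 <;> simp [h1, h2]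
  have hw : weight b q = gap b q / 2 ^ q.1 + gap b q / 2 ^ q.1 := by
    unfold weight
    ring
  unfold potential attack
  simp only [List.map_cons, List.sum_cons, List.map_append, List.sum_append, List.map_map,
    Function.comp_def]
  rw [sum_map_filter, sum_map_filter, hsplit, hw]
  linarith

/-- The properties of configurations preserved by the construction. -/
structure Invariant (b : ℕ → ℚ) (M : ℚ) (σ : Config) : Prop where
  pairwise : σ.2.1.Pairwise fun q r => q.1 ≠ r.1 ∧ q.2.1 ≠ r.2.1
  le : ∀ q ∈ σ.2.1, q.2.1 ≤ q.2.2
  gain_le : ∀ e, gain b σ.2.2 e ≤ 1 + M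

/-- Each program has at most one pending attempt, of gap at most `M`, and its gain is at most `1 +
M`: below `1` before the last answer, which adds at most `M`. -/
theorem Invariant.potential_le {b : ℕ → ℚ} {M : ℚ} {σ : Config} (h : Invariant b M σ)
    (hM0 : 0 ≤ M) (hM : ∀ q, gap b q ≤ M) : potential b σ ≤ 4 + 8 * M := by
  have h1 : (σ.2.1.map (weight b)).sum ≤ 2 * (2 * M) :=
    sum_map_div_two_pow_le (key := fun q : ℕ × ℕ × ℕ => q.1) fun k =>
      sum_map_ite_le_of_pairwise k (h.pairwise.imp fun h => h.1) (by positivity)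
        fun q _ _ => mul_le_mul_of_nonneg_left (hM q) zero_le_two
  have h2 : (σ.2.2.map fun w => weight b w.1).sum ≤ 2 * (2 * (1 + M)) := by
    refine sum_map_div_two_pow_le (key := fun w : (ℕ × ℕ × ℕ) × ℕ => w.1.1)
      (w := fun w => 2 * gap b w.1) fun k => ?_
    refine le_trans (le_of_eq ?_) (mul_le_mul_of_nonneg_left (h.gain_le k) zero_le_two)
    rw [gain, ← List.sum_map_mul_left]
    simp only [mul_ite, mul_zero]
  unfold potential
  linarith

theorem gain_attack (b : ℕ → ℚ) (σ : Config) (q : ℕ × ℕ × ℕ) (e : ℕ) :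
    gain b (attack σ q).2.2 e =
      (if q.1 = e then (σ.2.1.map fun r => if r.1 = e then gap b r else 0).sum else 0) +
        gain b σ.2.2 e := by
  unfold gain attack
  simp only [List.map_append, List.sum_append, List.map_map, Function.comp_def]
  rw [sum_map_filter σ.2.1 (fun r => r.1 = q.1) fun r => if r.1 = e then gap b r else 0]
  congr 1
  split_ifs with h
  · subst h
    congr 1
    refine List.map_congr_left fun r _ => ?_
    split_ifs <;> rfl
  · refine List.sum_eq_zero fun y hy => ?_
    obtain ⟨r, _, rfl⟩ := List.mem_map.1 hy
    split_ifs with h1 h2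
    · exact absurd (h1.symm.trans h2) h
    · rfl
    · rfl

theorem Invariant.attack {b : ℕ → ℚ} {M : ℚ} {σ : Config} (h : Invariant b M σ) (hM0 : 0 ≤ M)
    (hM : ∀ q, gap b q ≤ M) {q : ℕ × ℕ × ℕ} (hq : q.2.1 ≤ q.2.2) (hg : gain b σ.2.2 q.1 < 1) :
    Invariant b M (attack σ q) where
  pairwise := by
    unfold CostFunctions.attack
    refine List.pairwise_cons.2 ⟨fun r hr => ?_, h.pairwise.filter _⟩
    have := (List.mem_filter.1 hr).2
    simp only [decide_eq_true_eq] at this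
    exact ⟨this.1.symm, this.2.symm⟩
  le := by
    intro r hr
    rcases List.mem_cons.1 hr with rfl | hr
    · exact hq
    · exact h.le r (List.mem_filter.1 hr).1
  gain_le := by
    intro e
    rw [gain_attack]
    split_ifs with he
    · subst he
      have := sum_map_ite_le_of_pairwise (key := fun r : ℕ × ℕ × ℕ => r.1) (w := gap b) q.1
        (h.pairwise.imp fun h => h.1) hM0 fun r _ _ => hM r
      linarith
    · rw [zero_add]
      exact h.gain_le e

/-! ### The run of the construction -/

section Run

variable {a b : ℕ → ℚ}

/-- At stage `t` an attempt with `x` is made. -/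
def Acts (a b : ℕ → ℚ) (t x : ℕ) : Prop :=
  target a b (config a b t, t) = x ∧ x < stageIndex t

theorem Acts.config_succ {t x : ℕ} (h : Acts a b t x) :
    config a b (t + 1) = attack (config a b t) (stageProgram t, x, stageIndex t) := by
  obtain ⟨rfl, h⟩ := h
  exact if_pos h

theorem config_succ_of_forall_not {t : ℕ} (h : ∀ x, ¬ Acts a b t x) :
    config a b (t + 1) = config a b t :=
  if_neg fun h' => h _ ⟨rfl, h'⟩

theorem Acts.eligible {t x : ℕ} (h : Acts a b t x) : Eligible a b (config a b t) t x := by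
  classical
  obtain ⟨rfl, h⟩ := h
  exact (Nat.find_spec (exists_target a b (config a b t, t))).resolve_right (not_le.2 h)

theorem exists_acts_le {t x : ℕ} (h : Eligible a b (config a b t) t x) (hx : x < stageIndex t) :
    ∃ y ≤ x, Acts a b t y := by
  classical
  have : target a b (config a b t, t) ≤ x := Nat.find_min' _ (Or.inl h)
  exact ⟨_, this, rfl, this.trans_lt hx⟩

theorem invariant_config {M : ℚ} (hM : ∀ q, gap b q ≤ M) (t : ℕ) :
    Invariant b M (config a b t) := by
  have hM0 : 0 ≤ M := by simpa [gap] using hM (0, 0, 0)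
  induction t with
  | zero =>
    exact ⟨List.Pairwise.nil, fun q hq => absurd hq List.not_mem_nil, fun e => by
      change (0 : ℚ) ≤ _
      linarith⟩
  | succ t ih =>
    by_cases h : ∃ x, Acts a b t x
    · obtain ⟨x, h⟩ := h
      rw [h.config_succ]
      exact ih.attack hM0 hM h.2.le h.eligible.gain_lt
    · rw [config_succ_of_forall_not (not_exists.1 h)]
      exact ih

theorem Acts.potential_add_le (hb : Monotone b) {M : ℚ} (hM : ∀ q, gap b q ≤ M) {t x : ℕ}
    (h : Acts a b t x) : potential b (config a b t) + (b (stageIndex t) - b x) / 2 ^ stageProgram t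
      ≤ potential b (config a b (t + 1)) := by
  rw [h.config_succ]
  refine potential_attack (q := (stageProgram t, x, stageIndex t)) hb
    ((invariant_config hM t).pairwise.imp fun h => h.2) h.2.le fun r hr hx => ?_
  have := h.eligible.pending r hr (Or.inr hx)
  exact ⟨this.1, this.2.1⟩

theorem potential_mono (hb : Monotone b) {M : ℚ} (hM : ∀ q, gap b q ≤ M) :
    Monotone fun t => potential b (config a b t) := by
  refine monotone_nat_of_le_succ fun t => ?_
  by_cases h : ∃ x, Acts a b t x
  · obtain ⟨x, h⟩ := h
    refine le_trans ?_ (h.potential_add_le hb hM)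
    have : 0 ≤ (b (stageIndex t) - b x) / 2 ^ stageProgram t :=
      div_nonneg (sub_nonneg.2 (hb h.2.le)) (by positivity)
    linarith
  · rw [config_succ_of_forall_not (not_exists.1 h)]

theorem acts_of_mem_iff_ne {t x : ℕ}
    (h : ¬ (x ∈ (config a b t).1 ↔ x ∈ (config a b (t + 1)).1)) : Acts a b t x := by
  by_cases h' : ∃ y, Acts a b t y
  · obtain ⟨y, h'⟩ := h'
    rw [h'.config_succ] at h
    suffices x = y by rwa [this]
    by_contra hne
    apply h
    unfold attack
    dsimp only
    split_ifs <;> simp [hne]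
  · rw [config_succ_of_forall_not (not_exists.1 h')] at h
    exact absurd Iff.rfl h

/-- Only the number acted on changes, and `cost_lt` bounds the cost of this by what the potential
gains. -/
theorem changeCost_le_potential_sub (hb : Monotone b) {M : ℚ} (hM : ∀ q, gap b q ≤ M)
    {A : ℕ → Finset ℕ} (hA : ∀ t x, x ∈ A t ↔ x ∈ (config a b t).1) (t : ℕ) :
    changeCost (additiveCost a) A t ≤
      potential b (config a b (t + 1)) - potential b (config a b t) := by
  classical
  unfold changeCost
  split_ifs with h
  · have h1 := (Nat.find_spec h).2
    have h0 := (Nat.find_spec h).1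
    revert h0 h1
    generalize Nat.find h = x
    intro h1 h0
    rw [hA, hA] at h1
    have h2 := acts_of_mem_iff_ne h1
    have h3 := h2.potential_add_le hb hM
    have h4 := h2.eligible.cost_lt
    have h5 : a (t + 1) - a x < (b (stageIndex t) - b x) / 2 ^ stageProgram t := by
      rw [lt_div_iff₀ (by positivity)]
      linarith
    simp only [additiveCost, h0.le, if_true]
    linarith
  · exact sub_nonneg.2 (potential_mono hb hM t.le_succ)

theorem stageIndex_le (t : ℕ) : stageIndex t ≤ t :=
  (Nat.unpair_left_le _).trans (Nat.unpair_right_le _)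

theorem Acts.lt_of_monotone (ha : Monotone a) {t x : ℕ} (h : Acts a b t x) :
    b x < b (stageIndex t) := by
  have h1 := h.eligible.cost_lt
  have h2 : a x ≤ a (t + 1) := ha ((h.2.le.trans (stageIndex_le t)).trans t.le_succ)
  have h3 : 0 ≤ (2 : ℚ) ^ stageProgram t * (a (t + 1) - a x) :=
    mul_nonneg (by positivity) (sub_nonneg.2 h2)
  linarith

/-- Only programs `e ≤ x` use `x`, so each action on `x` raises the bounded potential by at least a
fixed positive amount. -/
theorem eventually_not_acts (ha : Monotone a) (hb : Monotone b) {M : ℚ}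
    (hM : ∀ q, gap b q ≤ M) (x : ℕ) :
    ∀ᶠ t in atTop, ¬ Acts a b t x := by
  have hM0 : 0 ≤ M := by simpa [gap] using hM (0, 0, 0)
  by_cases hx : ∃ n, b x < b n
  · classical
    -- As `b` is monotone, its first value above `b x` gives the least positive gap at `x`.
    obtain ⟨δ, hδ, hδ'⟩ : ∃ δ : ℚ, 0 < δ ∧ ∀ n, b x < b n → δ ≤ b n - b x :=
      ⟨b (Nat.find hx) - b x, sub_pos.2 (Nat.find_spec hx), fun n hn =>
        sub_le_sub_right (hb (Nat.find_min' hx hn)) _⟩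
    have hbdd : BddAbove (Set.range fun t => (potential b (config a b t) : ℝ)) := by
      refine ⟨((4 + 8 * M : ℚ) : ℝ), ?_⟩
      rintro _ ⟨t, rfl⟩
      exact Rat.cast_le.2 ((invariant_config hM t).potential_le hM0 hM)
    have hlim := tendsto_atTop_ciSup
      (fun s t h => Rat.cast_le.2 (potential_mono (a := a) hb hM h)) hbdd
    have hdiff := ((tendsto_add_atTop_iff_nat 1).2 hlim).sub hlim
    rw [sub_self] at hdiff
    have hpos : (0 : ℝ) < ((δ / 2 ^ x : ℚ) : ℝ) := Rat.cast_pos.2 (by positivity)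
    filter_upwards [hdiff.eventually_lt_const hpos] with t ht hact
    have h1 : potential b (config a b (t + 1)) - potential b (config a b t) < δ / 2 ^ x := by
      exact_mod_cast ht
    have h2 := hact.potential_add_le hb hM
    have h3 := hact.lt_of_monotone ha
    have h6 : δ / 2 ^ x ≤ (b (stageIndex t) - b x) / 2 ^ stageProgram t :=
      div_le_div₀ (by linarith [hδ' _ h3]) (hδ' _ h3) (by positivity)
        (pow_le_pow_right₀ (by norm_num) hact.eligible.le)
    linarith
  · exact Eventually.of_forall fun t h => hx ⟨_, h.lt_of_monotone ha⟩

end Run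

/-! ### The limit set, its cost, and the cost forced on an opponent -/

section Obedience

variable {a b : ℕ → ℚ}

/-- The set constructed. -/
def limitSet (a b : ℕ → ℚ) : Set ℕ := {x | ∀ᶠ t in atTop, x ∈ (config a b t).1}

theorem eventually_mem_iff (ha : Monotone a) (hb : Monotone b) {M : ℚ} (hM : ∀ q, gap b q ≤ M)
    (x : ℕ) : ∀ᶠ t in atTop, (x ∈ (config a b t).1 ↔ x ∈ limitSet a b) := by
  obtain ⟨T, hT⟩ := eventually_atTop.1 (eventually_not_acts ha hb hM x)
  have hconst : ∀ t ≥ T, (x ∈ (config a b t).1 ↔ x ∈ (config a b T).1) := by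
    intro t ht
    induction t, ht using Nat.le_induction with
    | base => exact Iff.rfl
    | succ t ht ih =>
      rw [← ih]
      by_contra h
      exact hT t ht (acts_of_mem_iff_ne fun h' => h h'.symm)
  refine eventually_atTop.2 ⟨T, fun t ht => ?_⟩
  rw [hconst t ht]
  constructor
  · exact fun h => eventually_atTop.2 ⟨T, fun s hs => (hconst s hs).2 h⟩
  · intro h
    obtain ⟨s, hs, hs'⟩ := (h.and (eventually_ge_atTop T)).exists
    exact (hconst s hs').1 hs

theorem obeys_limitSet (ha : Monotone a) (hb : Monotone b) (hae : EffRat a) (hbe : EffRat b)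
    {M : ℚ} (hM : ∀ q, gap b q ≤ M) : Obeys (limitSet a b) (additiveCost a) := by
  have hA : ∀ t x, x ∈ (config a b t).1.toFinset ↔ x ∈ (config a b t).1 := fun t x =>
    List.mem_toFinset
  have hM0 : 0 ≤ M := by simpa [gap] using hM (0, 0, 0)
  refine ⟨fun t => (config a b t).1.toFinset, ⟨⟨fun t => (config a b t).1,
    Computable.fst.comp (computable_config hae hbe), fun _ => rfl⟩, fun x => ?_⟩, ?_⟩
  · simpa only [hA] using eventually_mem_iff ha hb hM x
  · refine lt_of_le_of_lt (ENNReal.tsum_le_of_sum_range_le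
      (c := ENNReal.ofReal ((4 + 8 * M : ℚ) : ℝ)) fun n => ?_) ENNReal.ofReal_lt_top
    calc ∑ t ∈ Finset.range n, ENNReal.ofReal
          (changeCost (additiveCost a) (fun t => (config a b t).1.toFinset) t : ℝ)
        ≤ ∑ t ∈ Finset.range n, ENNReal.ofReal
          ((potential b (config a b (t + 1)) : ℝ) - potential b (config a b t)) := by
          refine Finset.sum_le_sum fun t _ => ENNReal.ofReal_le_ofReal ?_
          exact_mod_cast changeCost_le_potential_sub hb hM hA t
      _ = ENNReal.ofReal (∑ t ∈ Finset.range n,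
          ((potential b (config a b (t + 1)) : ℝ) - potential b (config a b t))) :=
          (ENNReal.ofReal_sum_of_nonneg fun t _ => sub_nonneg.2
            (Rat.cast_le.2 (potential_mono hb hM t.le_succ))).symm
      _ ≤ _ := by
          rw [Finset.sum_range_sub fun t => (potential b (config a b t) : ℝ)]
          refine ENNReal.ofReal_le_ofReal ?_
          have h0 : potential b (config a b 0) = 0 := by
            change (0 : ℚ) + 0 = 0
            simp
          rw [h0, Rat.cast_zero, sub_zero]
          exact Rat.cast_le.2 ((invariant_config hM n).potential_le hM0 hM)

theorem changeCost_nonneg (hb : Monotone b) (E : ℕ → Finset ℕ) (s : ℕ) :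
    0 ≤ changeCost (additiveCost b) E s := by
  unfold changeCost
  split_ifs
  · exact additiveCost_nonneg hb _ _
  · exact le_rfl

/-- Some single change between `i` and `j` affects `x`. The least number it affects is at most `x`,
so its cost is already large enough. -/
theorem sub_le_sum_changeCost (hb : Monotone b) {E : ℕ → Finset ℕ} {x i j : ℕ} (hx : x ≤ i)
    (hij : i ≤ j) (h : ¬ (x ∈ E i ↔ x ∈ E j)) :
    b i - b x ≤ ∑ s ∈ Finset.Ico i j, changeCost (additiveCost b) E s := by
  classical
  obtain ⟨s, hs, hsx⟩ : ∃ s ∈ Finset.Ico i j, ¬ (x ∈ E s ↔ x ∈ E (s + 1)) := by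
    by_contra! hall
    apply h
    clear h
    induction j, hij using Nat.le_induction with
    | base => exact Iff.rfl
    | succ j hj ih =>
      refine (ih fun s hs => hall s ?_).trans (hall j (Finset.mem_Ico.2 ⟨hj, j.lt_succ_self⟩))
      rw [Finset.mem_Ico] at hs ⊢
      exact ⟨hs.1, hs.2.trans j.lt_succ_self⟩
  refine le_trans ?_ (Finset.single_le_sum (fun s _ => changeCost_nonneg hb E s) hs)
  have his := (Finset.mem_Ico.1 hs).1
  have hex : ∃ y, y < s + 1 ∧ ¬ (y ∈ E s ↔ y ∈ E (s + 1)) :=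
    ⟨x, Nat.lt_succ_of_le (hx.trans his), hsx⟩
  have hle : Nat.find hex ≤ x := Nat.find_min' hex ⟨Nat.lt_succ_of_le (hx.trans his), hsx⟩
  have heq : changeCost (additiveCost b) E s = b (s + 1) - b (Nat.find hex) := by
    unfold changeCost
    rw [dif_pos hex]
    exact if_pos (Nat.find_spec hex).1.le
  rw [heq]
  exact sub_le_sub (hb (his.trans s.le_succ)) (hb hle)

/-- Start the approximation at stage `n`, leaving only a tail of the convergent sum. -/
theorem exists_totalCost_lt_one {S : Set ℕ} {c : ℕ → ℕ → ℚ} (h : Obeys S c) :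
    ∃ E, IsComputableApprox E S ∧ totalCost c E < 1 := by
  obtain ⟨E, ⟨⟨l, hl, hlE⟩, hE⟩, hc⟩ := h
  obtain ⟨n, hn⟩ := ((ENNReal.tendsto_sum_nat_add _ hc.ne).eventually_lt_const
    zero_lt_one).exists
  have hmax : Computable fun s => max s n :=
    (Primrec.nat_max.comp Primrec.id (Primrec.const n)).to_comp
  refine ⟨fun s => E (max s n), ⟨⟨fun s => l (max s n), hl.comp hmax, fun s => hlE _⟩, fun x => ?_⟩,
    ?_⟩
  · filter_upwards [hE x, eventually_ge_atTop n] with s hs hsn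
    rwa [max_eq_left hsn]
  · refine lt_of_le_of_lt (le_of_eq ?_) hn
    unfold totalCost
    rw [← Summable.sum_add_tsum_nat_add' (k := n) ENNReal.summable, Finset.sum_eq_zero, zero_add]
    · refine tsum_congr fun s => ?_
      have h1 : max (s + n) n = s + n := max_eq_left (Nat.le_add_left n s)
      have h2 : max (s + n + 1) n = s + n + 1 := max_eq_left (by omega)
      simp only [changeCost, h1, h2]
    · intro s hs
      have hs := Finset.mem_range.1 hs
      have h1 : max s n = n := max_eq_right hs.le
      have h2 : max (s + 1) n = n := max_eq_right hs
      simp [changeCost, h1, h2]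

/-- The relation between the successful attempts against a program and the cost of the sequence
`E` that it computes. -/
structure Faithful (b : ℕ → ℚ) (E : ℕ → Finset ℕ) (e : ℕ) (σ : Config) : Prop where
  mem_iff : ∀ q ∈ σ.2.1, q.1 = e → (q.2.1 ∈ E q.2.2 ↔ q.2.1 ∉ σ.1)
  answered_le : ∀ q ∈ σ.2.1, q.1 = e → ∀ w ∈ σ.2.2, w.1.1 = e → w.2 ≤ q.2.2
  gain_le : ∀ r, (∀ w ∈ σ.2.2, w.1.1 = e → w.2 ≤ r) →
    gain b σ.2.2 e ≤ ∑ s ∈ Finset.range r, changeCost (additiveCost b) E s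

theorem Acts.mem_getD_iff {E : ℕ → Finset ℕ} {t x : ℕ} (h : Acts a b t x)
    (hE : ∀ i s l, opponent (stageProgram t) i s = some l → ∀ y, y ∈ l ↔ y ∈ E i) (y : ℕ) :
    y ∈ (opponent (stageProgram t) (stageIndex t) t).getD [] ↔ y ∈ E (stageIndex t) := by
  obtain ⟨l, hl⟩ := Option.isSome_iff_exists.1 h.eligible.isSome
  rw [hl]
  exact hE _ _ _ hl y

end Obedience

/-! ### What opponents pay, and how long attempts stay pending -/

section Opponents

variable {a b : ℕ → ℚ}

theorem Invariant.eq_of_fst_eq {M : ℚ} {σ : Config} (h : Invariant b M σ) {q r : ℕ × ℕ × ℕ}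
    (hq : q ∈ σ.2.1) (hr : r ∈ σ.2.1) (hqr : q.1 = r.1) : q = r := by
  have hsymm : Std.Symm fun q r : ℕ × ℕ × ℕ => q.1 ≠ r.1 ∧ q.2.1 ≠ r.2.1 :=
    { symm := fun _ _ h => ⟨h.1.symm, h.2.symm⟩ }
  by_contra hne
  exact (h.pairwise.forall hq hr hne).1 hqr

theorem mem_attack_of_ne {σ : Config} {q : ℕ × ℕ × ℕ} {y : ℕ} (h : y ≠ q.2.1) :
    y ∈ (attack σ q).1 ↔ y ∈ σ.1 := by
  unfold attack
  dsimp only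
  split_ifs <;> simp [h]

theorem mem_attack_self {σ : Config} {q : ℕ × ℕ × ℕ} :
    q.2.1 ∈ (attack σ q).1 ↔ q.2.1 ∉ σ.1 := by
  unfold attack
  dsimp only
  split_ifs with h <;> simp [h]

theorem mem_pending_attack {σ : Config} {q r : ℕ × ℕ × ℕ} :
    r ∈ (attack σ q).2.1 ↔ r = q ∨ r ∈ σ.2.1 ∧ r.1 ≠ q.1 ∧ r.2.1 ≠ q.2.1 := by
  simp [attack]

theorem mem_answered_attack {σ : Config} {q : ℕ × ℕ × ℕ} {w : (ℕ × ℕ × ℕ) × ℕ} :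
    w ∈ (attack σ q).2.2 ↔ (w.1 ∈ σ.2.1 ∧ w.1.1 = q.1 ∧ w.2 = q.2.2) ∨ w ∈ σ.2.2 := by
  obtain ⟨r, j⟩ := w
  simp only [attack, List.mem_append, List.mem_map, List.mem_filter, decide_eq_true_eq,
    Prod.mk.injEq]
  constructor
  · rintro (⟨r', ⟨h1, h2⟩, rfl, rfl⟩ | h)
    · exact Or.inl ⟨h1, h2, rfl⟩
    · exact Or.inr h
  · rintro (⟨h1, h2, rfl⟩ | h)
    · exact Or.inl ⟨r, ⟨h1, h2⟩, rfl, rfl⟩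
    · exact Or.inr h

/-- `E` disagrees with `A` on the attempted number at the index of the attempt and agrees at the
index of the answer, so it pays the gap in between. These intervals follow one another, so the
payments add up. -/
theorem faithful_config (hb : Monotone b) {M : ℚ} (hM : ∀ q, gap b q ≤ M) {E : ℕ → Finset ℕ}
    {e : ℕ} (hE : ∀ i t l, opponent e i t = some l → ∀ y, y ∈ l ↔ y ∈ E i) (t : ℕ) :
    Faithful b E e (config a b t) := by
  induction t with
  | zero =>
    refine ⟨fun q hq => absurd hq List.not_mem_nil, fun q hq => absurd hq List.not_mem_nil,
      fun r _ => ?_⟩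
    exact Finset.sum_nonneg fun s _ => changeCost_nonneg hb E s
  | succ t ih =>
    by_cases h : ∃ x, Acts a b t x
    swap
    · rw [config_succ_of_forall_not (not_exists.1 h)]
      exact ih
    obtain ⟨x, h⟩ := h
    have inv := invariant_config (a := a) hM t
    rw [h.config_succ]
    have hel := h.eligible
    refine ⟨fun q hq hqe => ?_, fun q hq hqe w hw hwe => ?_, fun r hr => ?_⟩
    · rcases mem_pending_attack.1 hq with rfl | ⟨hq, -, hqx⟩
      · rw [mem_attack_self]
        rw [not_not]
        dsimp only at hqe
        subst hqe
        exact (h.mem_getD_iff (E := E) hE x).symm.trans hel.agree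
      · rw [mem_attack_of_ne hqx]
        exact ih.mem_iff q hq hqe
    · rcases mem_pending_attack.1 hq with rfl | ⟨hq, hqe', -⟩
      · rcases mem_answered_attack.1 hw with ⟨-, -, hw⟩ | hw
        · exact hw.le
        · exact hel.answered w hw (hwe.trans hqe.symm)
      · rcases mem_answered_attack.1 hw with ⟨-, hw, -⟩ | hw
        · exact absurd ((hqe.trans hwe.symm).trans hw) hqe'
        · exact ih.answered_le q hq hqe w hw hwe
    · rw [gain_attack]
      have hr' : ∀ w ∈ (config a b t).2.2, w.1.1 = e → w.2 ≤ r := fun w hw =>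
        hr w (mem_answered_attack.2 (Or.inr hw))
      split_ifs with he
      swap
      · rw [zero_add]
        exact ih.gain_le r hr'
      dsimp only at he
      by_cases hq : ∃ q ∈ (config a b t).2.1, q.1 = e
      · obtain ⟨q, hq, hqe⟩ := hq
        have hcomp := hel.pending q hq (Or.inl (hqe.trans he.symm))
        have hir : stageIndex t ≤ r :=
          hr (q, stageIndex t) (mem_answered_attack.2 (Or.inl ⟨hq, hqe.trans he.symm, rfl⟩)) hqe
        have h1 : gain b (config a b t).2.2 e ≤
            ∑ s ∈ Finset.range q.2.2, changeCost (additiveCost b) E s :=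
          ih.gain_le _ (ih.answered_le q hq hqe)
        have h2 : gap b q ≤
            ∑ s ∈ Finset.Ico q.2.2 (stageIndex t), changeCost (additiveCost b) E s := by
          refine sub_le_sum_changeCost hb (inv.le q hq) hcomp.2.1 ?_
          subst he
          rw [ih.mem_iff q hq hqe, ← h.mem_getD_iff (E := E) hE, hcomp.2.2]
          exact not_iff_self
        have h3 : ((config a b t).2.1.map fun r => if r.1 = e then gap b r else 0).sum ≤
            ∑ s ∈ Finset.Ico q.2.2 (stageIndex t), changeCost (additiveCost b) E s := by
          refine sum_map_ite_le_of_pairwise (key := fun r : ℕ × ℕ × ℕ => r.1) e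
            (inv.pairwise.imp fun h => h.1)
            (Finset.sum_nonneg fun s _ => changeCost_nonneg hb E s) fun r hr hre => ?_
          rwa [inv.eq_of_fst_eq hr hq (hre.trans hqe.symm)]
        have h4 := Finset.sum_range_add_sum_Ico (changeCost (additiveCost b) E) hcomp.2.1
        have h5 : ∑ s ∈ Finset.range (stageIndex t), changeCost (additiveCost b) E s ≤
            ∑ s ∈ Finset.range r, changeCost (additiveCost b) E s :=
          Finset.sum_le_sum_of_subset_of_nonneg (Finset.range_mono hir)
            fun s _ _ => changeCost_nonneg hb E s
        linarith
      · have h3 := sum_map_ite_le_of_pairwise (key := fun r : ℕ × ℕ × ℕ => r.1) (w := gap b)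
          (C := 0) e (inv.pairwise.imp fun h => h.1) le_rfl
          fun r hr hre => absurd ⟨r, hr, hre⟩ hq
        have h4 := ih.gain_le r hr'
        linarith

theorem exists_forall_mem_le {γ : Type*} (l : List γ) (f : γ → ℕ) : ∃ r, ∀ w ∈ l, f w ≤ r := by
  induction l with
  | nil => exact ⟨0, fun w hw => absurd hw List.not_mem_nil⟩
  | cons q l ih =>
    obtain ⟨r, hr⟩ := ih
    refine ⟨max (f q) r, fun w hw => ?_⟩
    rcases List.mem_cons.1 hw with rfl | hw
    · exact le_max_left _ _
    · exact (hr w hw).trans (le_max_right _ _)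

theorem Faithful.gain_lt_one (hb : Monotone b) {E : ℕ → Finset ℕ} {e : ℕ} {σ : Config}
    (h : Faithful b E e σ) (hE : totalCost (additiveCost b) E < 1) : gain b σ.2.2 e < 1 := by
  obtain ⟨r, hr⟩ := exists_forall_mem_le σ.2.2 fun w => w.2
  refine (h.gain_le r fun w hw _ => hr w hw).trans_lt ?_
  have h1 := (ENNReal.sum_le_tsum (f := fun s =>
    ENNReal.ofReal (changeCost (additiveCost b) E s : ℝ)) (Finset.range r)).trans_lt hE
  rw [← ENNReal.ofReal_sum_of_nonneg fun s _ => Rat.cast_nonneg.2 (changeCost_nonneg hb E s),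
    ENNReal.ofReal_lt_one] at h1
  exact_mod_cast h1

theorem mem_pending_of_succ {t : ℕ} {q : ℕ × ℕ × ℕ} (h : q ∈ (config a b (t + 1)).2.1) :
    q ∈ (config a b t).2.1 ∨ stageProgram t = q.1 ∧ Acts a b t q.2.1 := by
  by_cases h' : ∃ x, Acts a b t x
  · obtain ⟨x, h'⟩ := h'
    rw [h'.config_succ] at h
    rcases mem_pending_attack.1 h with rfl | ⟨h, -, -⟩
    · exact Or.inr ⟨rfl, h'⟩
    · exact Or.inl h
  · rw [config_succ_of_forall_not (not_exists.1 h')] at h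
    exact Or.inl h

theorem mem_answered_of_succ {t : ℕ} {w : (ℕ × ℕ × ℕ) × ℕ} (h : w ∈ (config a b (t + 1)).2.2) :
    w ∈ (config a b t).2.2 ∨ stageProgram t = w.1.1 ∧ ∃ x, Acts a b t x := by
  by_cases h' : ∃ x, Acts a b t x
  · obtain ⟨x, h'⟩ := h'
    rw [h'.config_succ] at h
    rcases mem_answered_attack.1 h with ⟨-, h, -⟩ | h
    · exact Or.inr ⟨h.symm, x, h'⟩
    · exact Or.inl h
  · rw [config_succ_of_forall_not (not_exists.1 h')] at h
    exact Or.inl h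

theorem mem_pending_of_le {T t : ℕ} (hTt : T ≤ t) {q : ℕ × ℕ × ℕ}
    (hq : ∀ s ≥ T, ¬ (stageProgram s = q.1 ∧ Acts a b s q.2.1))
    (h : q ∈ (config a b t).2.1) : q ∈ (config a b T).2.1 := by
  induction t, hTt using Nat.le_induction with
  | base => exact h
  | succ t ht ih => exact ih ((mem_pending_of_succ h).resolve_right (hq t ht))

theorem mem_answered_of_le {T t : ℕ} (hTt : T ≤ t) {w : (ℕ × ℕ × ℕ) × ℕ}
    (hw : ∀ s ≥ T, ∀ x, ¬ (stageProgram s = w.1.1 ∧ Acts a b s x))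
    (h : w ∈ (config a b t).2.2) : w ∈ (config a b T).2.2 := by
  induction t, hTt using Nat.le_induction with
  | base => exact h
  | succ t ht ih =>
    exact ih ((mem_answered_of_succ h).resolve_right fun ⟨h1, x, h2⟩ => hw t ht x ⟨h1, h2⟩)

/-- All but finitely many numbers are not kept from `e` forever by programs with smaller code. -/
theorem finite_setOf_blocked {M : ℚ} (hM : ∀ q, gap b q ≤ M) (e : ℕ) :
    {x | ∃ e' < e, ∀ᶠ t in atTop, ∃ i, (e', x, i) ∈ (config a b t).2.1}.Finite := by
  have h : {x | ∃ e' < e, ∀ᶠ t in atTop, ∃ i, (e', x, i) ∈ (config a b t).2.1} =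
      ⋃ e' ∈ Set.Iio e, {x | ∀ᶠ t in atTop, ∃ i, (e', x, i) ∈ (config a b t).2.1} := by
    ext x
    simp
  rw [h]
  refine (Set.finite_Iio e).biUnion fun e' _ => Set.Subsingleton.finite fun x hx y hy => ?_
  obtain ⟨t, ⟨i, hi⟩, ⟨j, hj⟩⟩ := (Filter.Eventually.and hx hy).exists
  have := (invariant_config (a := a) hM t).eq_of_fst_eq hi hj rfl
  simp only [Prod.mk.injEq] at this
  exact this.2.1

/-- Once `x` is no longer acted on, no new attempts on `x` appear; so a program that is absent once
stays absent. -/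
theorem eventually_not_blocked {e x : ℕ} (hx : ∀ᶠ t in atTop, ¬ Acts a b t x)
    (h : ¬ ∃ e' < e, ∀ᶠ t in atTop, ∃ i, (e', x, i) ∈ (config a b t).2.1) :
    ∀ᶠ t in atTop, ∀ q ∈ (config a b t).2.1, q.2.1 = x → e ≤ q.1 := by
  obtain ⟨T, hT⟩ := eventually_atTop.1 hx
  have h1 : ∀ e' < e, ∀ᶠ t in atTop, ∀ i, (e', x, i) ∉ (config a b t).2.1 := by
    intro e' he'
    have h2 : ¬ ∀ᶠ t in atTop, ∃ i, (e', x, i) ∈ (config a b t).2.1 := fun h3 => h ⟨e', he', h3⟩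
    rw [not_eventually] at h2
    obtain ⟨T', hT', h4⟩ := frequently_atTop.1 h2 T
    refine eventually_atTop.2 ⟨T', fun t ht i hi => h4 ⟨i, mem_pending_of_le ht ?_ hi⟩⟩
    exact fun s hs hs' => hT s (le_trans hT' hs) hs'.2
  have h5 := (Set.finite_Iio e).eventually_all.2 h1
  filter_upwards [h5] with t ht q hq hqx
  by_contra hlt
  subst hqx
  exact ht q.1 (not_le.1 hlt) q.2.2 hq

end Opponents

/-! ### The limit set disobeys the second cost function -/

theorem exists_gap_le {b : ℕ → ℚ} {β : ℝ} (hb : IsLeftCEApprox b β) :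
    ∃ M : ℚ, ∀ q, gap b q ≤ M := by
  obtain ⟨n, hn⟩ := exists_nat_ge (β - b 0)
  refine ⟨n, fun q => ?_⟩
  have h1 := hb.le q.2.2
  have h2 : (b 0 : ℝ) ≤ b q.2.1 := Rat.cast_le.2 (hb.monotone (Nat.zero_le _))
  have h3 : ((b q.2.2 : ℝ) - b q.2.1) ≤ n := by linarith
  unfold gap
  exact_mod_cast h3

/-- The third component coded in `t` is free, so every pair of program and index recurs at late
stages. -/
theorem exists_stage (e i T : ℕ) : ∃ t ≥ T, stageProgram t = e ∧ stageIndex t = i :=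
  ⟨Nat.pair e (Nat.pair i T), (Nat.right_le_pair i T).trans (Nat.right_le_pair e _),
    by simp [stageProgram], by simp [stageIndex]⟩

theorem not_obeys_limitSet {α β : ℝ} {a b : ℕ → ℚ} (ha : IsLeftCEApprox a α)
    (hb : IsLeftCEApprox b β)
    (hab : ∀ N n₀ : ℕ, ∃ n ≥ n₀, (N : ℝ) * (α - a n) < β - b n) :
    ¬ Obeys (limitSet a b) (additiveCost b) := by
  intro hobeys
  obtain ⟨M, hM⟩ := exists_gap_le hb
  obtain ⟨E, ⟨⟨l, hl, hlE⟩, hE⟩, hcost⟩ := exists_totalCost_lt_one hobeys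
  obtain ⟨e, he, he'⟩ := exists_opponent hl
  have hopp : ∀ i t l', opponent e i t = some l' → ∀ y, y ∈ l' ↔ y ∈ E i := by
    intro i t l' hl' y
    rw [he' i t l' hl', ← hlE, List.mem_toFinset]
  have hgain : ∀ t, gain b (config a b t).2.2 e < 1 := fun t =>
    (faithful_config hb.monotone hM hopp t).gain_lt_one hb.monotone hcost
  have hacts := eventually_not_acts ha.monotone hb.monotone hM
  have hmem := eventually_mem_iff ha.monotone hb.monotone hM
  obtain ⟨n, hn⟩ := (finite_setOf_blocked (a := a) hM e).bddAbove
  -- The factor `2 ^ e` is that of `cost_lt`; `n + 1` avoids numbers blocked forever by smaller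
  -- codes, and `e` secures `e ≤ x`.
  obtain ⟨x, hx, hgood⟩ := hab (2 ^ e) (max (n + 1) e)
  have hxe : e ≤ x := (le_max_right _ _).trans hx
  have hfree := eventually_not_blocked (hacts x) fun hblocked =>
    absurd (hn hblocked) (not_le.2 ((le_max_left _ _).trans hx))
  obtain ⟨T, hT⟩ := eventually_atTop.1 (((Set.finite_Iic x).eventually_all.2
    fun y _ => hacts y).and ((hmem x).and hfree))
  have hgood' : ∀ᶠ i in atTop, ((2 ^ e * (α - a x) + b x : ℝ)) < b i :=
    hb.eventually_lt (by push_cast at hgood; linarith)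
  obtain ⟨j, hj⟩ := exists_forall_mem_le (config a b T).2.1 fun q => q.2.2
  obtain ⟨I, hI⟩ := eventually_atTop.1 ((hE x).and (hgood'.and
    ((eventually_gt_atTop x).and (eventually_ge_atTop j))))
  have key : ∀ t ≥ T, stageProgram t = e → I ≤ stageIndex t →
      (opponent e (stageIndex t) t).isSome →
      (∀ q ∈ (config a b t).2.1, q.1 = e → q.2.2 ≤ stageIndex t ∧
        (q.2.1 ∈ E (stageIndex t) ↔ q.2.1 ∈ (config a b t).1)) →
      (∀ w ∈ (config a b t).2.2, w.1.1 = e → w.2 ≤ stageIndex t) → False := by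
    intro t ht hte hIt hsome hQ hW
    obtain ⟨hT1, hT2, hT3⟩ := hT t ht
    obtain ⟨hI1, hI2, hI3, hI4⟩ := hI _ hIt
    obtain ⟨l', hl'⟩ := Option.isSome_iff_exists.1 hsome
    have hE' : ∀ y, y ∈ (opponent e (stageIndex t) t).getD [] ↔ y ∈ E (stageIndex t) := by
      intro y
      rw [hl']
      exact hopp _ _ _ hl' y
    have hel : Eligible a b (config a b t) t x := by
      subst hte
      refine ⟨hsome, hxe, ?_, fun q hq hqx => ?_, hW, hgain t, ?_⟩
      · rw [hE', hI1, hT2]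
      · rcases hqx with hqe | hqx
        · rw [hE']
          exact ⟨hqe.ge, hQ q hq hqe⟩
        · refine ⟨hT3 q hq hqx, ?_, ?_⟩
          · refine (hj q (mem_pending_of_le ht (fun s hs h => ?_) hq)).trans hI4
            exact (hT s hs).1 x (Set.mem_Iic.2 le_rfl) (hqx ▸ h.2)
          · rw [hE', hqx, hI1, hT2]
      · have h1 := ha.le (t + 1)
        have h2 : (2 : ℝ) ^ stageProgram t * (a (t + 1) - a x) ≤
            2 ^ stageProgram t * (α - a x) :=
          mul_le_mul_of_nonneg_left (by linarith) (by positivity)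
        have h3 : (2 : ℝ) ^ stageProgram t * (a (t + 1) - a x) < b (stageIndex t) - b x := by
          linarith
        exact_mod_cast h3
    obtain ⟨y, hy, hact⟩ := exists_acts_le hel hI3
    exact hT1 y hy hact
  -- If `e` acts infinitely often, it acts at some late stage on a `y > I`. The eligibility of `y`
  -- gives the conditions on the attempts of `e`, so `x` is eligible as well.
  by_cases hinf : ∃ᶠ t in atTop, stageProgram t = e ∧ ∃ y, Acts a b t y
  · obtain ⟨t, ⟨hte, y, hact⟩, htT, hsmall⟩ := (hinf.and_eventually
      ((eventually_ge_atTop T).and ((Set.finite_Iic I).eventually_all.2 fun y _ => hacts y))).exists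
    subst hte
    have hIy : I < y := by
      by_contra hle
      exact hsmall y (not_lt.1 hle) hact
    refine key t htT rfl (hIy.le.trans hact.2.le) hact.eligible.isSome (fun q hq hqe => ?_)
      hact.eligible.answered
    have h1 := hact.eligible.pending q hq (Or.inl hqe)
    rw [hact.mem_getD_iff (E := E) hopp] at h1
    exact h1.2
  · rw [not_frequently] at hinf
    obtain ⟨T', hT'⟩ := eventually_atTop.1 hinf
    obtain ⟨j', hj'⟩ := exists_forall_mem_le (config a b (max T T')).2.2 fun w => w.2
    obtain ⟨k, hk⟩ := exists_forall_mem_le (config a b (max T T')).2.1 fun q => q.2.2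
    -- Now the attempts of `e` no longer grow in number. Take an index at which `E` has its limit
    -- value on all pending numbers; at a late stage `A` has this value too, so the attempts of `e`
    -- appear answered.
    obtain ⟨i, hi, hij, hik, hIi⟩ := (((List.finite_toSet
      (config a b (max T T')).2.1).eventually_all.2 fun q _ => hE q.2.1).and
      ((eventually_ge_atTop j').and ((eventually_ge_atTop k).and (eventually_ge_atTop I)))).exists
    obtain ⟨t₀, ht₀⟩ := he i
    obtain ⟨T'', hT''⟩ := eventually_atTop.1 ((List.finite_toSet
      (config a b (max T T')).2.1).eventually_all.2 fun q _ => hmem q.2.1)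
    obtain ⟨t, ht, hte, hti⟩ := exists_stage e i (max (max T T') (max t₀ T''))
    subst hti
    have hle : max T T' ≤ t := (le_max_left _ _).trans ht
    have hle₀ : t₀ ≤ t := (le_max_left _ _).trans ((le_max_right _ _).trans ht)
    have hle'' : T'' ≤ t := (le_max_right _ _).trans ((le_max_right _ _).trans ht)
    refine key t ((le_max_left _ _).trans hle) hte hIi
      (Option.isSome_iff_exists.2 ⟨_, opponent_mono hle₀ ht₀⟩) (fun q hq hqe => ?_)
      (fun w hw hwe => ?_)
    · have hq' := mem_pending_of_le hle (fun s hs h =>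
        hT' s ((le_max_right _ _).trans hs) ⟨h.1.trans hqe, _, h.2⟩) hq
      exact ⟨(hk q hq').trans hik, (hi q hq').trans (hT'' t hle'' q hq').symm⟩
    · exact (hj' w (mem_answered_of_le hle (fun s hs y h =>
        hT' s ((le_max_right _ _).trans hs) ⟨h.1.trans hwe, y, h.2⟩) hw)).trans hij

theorem solovayLE_of_costImplies {α β : ℝ} (hβ : 0 < β) {a b : ℕ → ℚ} (ha : IsLeftCEApprox a α)
    (hb : IsLeftCEApprox b β) (h : CostImplies (additiveCost a) (additiveCost b)) :
    SolovayLE β α := by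
  by_contra hnot
  obtain ⟨M, hM⟩ := exists_gap_le hb
  refine not_obeys_limitSet ha hb (fun N n₀ => ?_)
    (h _ (obeys_limitSet ha.monotone hb.monotone ha.effRat hb.effRat hM))
  by_contra! hle
  exact hnot (solovayLE_of_forall_ge_le ha hb hβ N n₀ hle)

end CostFunctions

theorem mainTheorem4 (α β : ℝ) (hα : CostFunctions.IsLeftCE α) (hβ : CostFunctions.IsLeftCE β)
    (hα0 : 0 < α) (hβ0 : 0 < β) :
    List.TFAE [
      CostFunctions.SolovayLE β α,
      ∀ a : ℕ → ℚ, CostFunctions.IsLeftCEApprox a α →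
        CostFunctions.IsProper (CostFunctions.additiveCost a) →
        ∃ b : ℕ → ℚ, CostFunctions.IsLeftCEApprox b β ∧
          CostFunctions.CostImplies (CostFunctions.additiveCost a)
            (CostFunctions.additiveCost b),
      ∃ a : ℕ → ℚ, CostFunctions.IsLeftCEApprox a α ∧
        ∃ b : ℕ → ℚ, CostFunctions.IsLeftCEApprox b β ∧
          CostFunctions.CostImplies (CostFunctions.additiveCost a)
            (CostFunctions.additiveCost b)] := by
  tfae_have 1 → 2 := fun h _ ha hp => CostFunctions.exists_costImplies_of_solovayLE hα0 h ha hp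
  tfae_have 2 → 3 := by
    intro h
    obtain ⟨a, ha, hp⟩ := CostFunctions.exists_isProper_approx hα
    exact ⟨a, ha, h a ha hp⟩
  tfae_have 3 → 1 := by
    rintro ⟨a, ha, b, hb, h⟩
    exact CostFunctions.solovayLE_of_costImplies hβ0 ha hb h
  tfae_finish
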